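/- Let $n\ge 2$, $m\ge 1$. For $s\ge 0$ let $B^{s}$ be the Kirillov--Reshetikhin crystal of $U_q(\widehat{\mathfrak{sl}}_n)$ for the $s$-th symmetric power of the standard representation: its elements are the one-row semistandard tableaux of length $s$ in the letters $1,\dots,n$ (read modulo $n$), and for $i\in\mathbb Z/n\mathbb Z$ the operator $f_i$ changes one letter $i$ into $i+1$ (so $f_0$ changes $n$ into $1$), $\varphi_i(b)$ and $\varepsilon_i(b)$ being the numbers of letters $i$ and $i+1$ in $b$. On a tensor product, $f_i(b\otimes b')=f_i(b)\otimes b'$ if $\varphi_i(b')\le\varepsilon_i(b)$, and $f_i(b\otimes b')=b\otimes f_i(b')$ otherwise; $e_i$ is the partial inverse of $f_i$. Let $R:B^{s}\otimes B^{t}\to B^{t}\otimes B^{s}$ be the combinatorial $R$-matrix, that is, the unique isomorphism of affine crystals, and let $H:B^{s}\otimes B^{t}\to\mathbb Z$ be the local coenergy, that is, the unique function with $H(1^s\otimes 1^t)=0$ that is invariant under $e_i$ for $i\ne0$ and satisfies, whenever $e_0(x)$ is defined, $H(e_0x)=H(x)+1$, $H(x)-1$ or $H(x)$ according as $e_0$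 acts on the left factor of both $x$ and $R(x)$, on the right factor of both, or on different sides. Let $B=B_1\otimes\cdots\otimes B_m$ with $B_i=B^{s_i}$, and let $b=b_1\otimes\cdots\otimes b_m\in B$. For $i\le k$ let $b_i^{[i]}=b_i$ and let $b_i^{[k+1]}\in B_i$ be the second factor of $R\big(b_i^{[k]}\otimes b_{k+1}\big)\in B_{k+1}\otimes B_i$. The intrinsic energy of $b$ is $$D_B(b)=\sum_{1\le i<j\le m}H\big(b_i^{[j-1]}\otimes b_j\big).$$ Write $x_i^{(r+i-1)}$, with upper index in $\mathbb Z/n\mathbb Z$, for the number of $r$'s in $b_i$. Then $$D_B(b)=\min_T\Big\{\sum_{(i,j)\in(n-1)\delta_{m-1}}x_{T(i,j)}^{(i-j)}\Big\},$$ where $(n-1)\delta_{m-1}$ is the shape with rows of lengths $(n-1)(m-1),(n-1)(m-2),\dots,n-1$, the cell $(i,j)$ lies in row $i$ and column $j$, and the minimum is over all semistandard tableaux $T$ of this shape (rows weakly increasing, columns strictly increasing) with entries in $\{1,\dots,m\}$. -/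

import Mathlib

namespace KRCrystal

/-- The Kirillov-Reshetikhin crystal of the `s`-th symmetric power of the standard representation:
one-row semistandard tableaux of length `s` in the letters `1, …, n`.  Letters are taken in `ℤ/nℤ`
(the letter `n` is the residue `0`), and a one-row tableau is recorded by the number `count r` of
boxes that contain `r`. -/
@[ext]
structure Row (n s : ℕ) [NeZero n] where
  count : ZMod n → ℕ
  sum_count : ∑ r, count r = s

variable {n : ℕ} [NeZero n]

/-- `ε_i(b)`: how many times `e_i` can be applied, that is, the number of letters `i + 1`. -/
def Row.eps {s : ℕ} (i : ZMod n) (b : Row n s) : ℕ := b.count (i + 1)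

/-- `φ_i(b)`: how many times `f_i` can be applied, that is, the number of letters `i`. -/
def Row.phi {s : ℕ} (i : ZMod n) (b : Row n s) : ℕ := b.count i

/-- The arrow `b → b'` of colour `i` in the crystal graph, i.e. `f_i b = b'`, equivalently
`e_i b' = b`: one letter `i` of `b` is replaced by `i + 1`.  For `i = 0` a letter `n` becomes `1`. -/
def Row.Arrow {s : ℕ} (i : ZMod n) (b b' : Row n s) : Prop :=
  ∀ r, b'.count r + (if r = i then 1 else 0) = b.count r + (if r = i + 1 then 1 else 0)

/-- The one-row tableau all of whose letters are `1`. -/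
def Row.ones (n s : ℕ) [NeZero n] : Row n s where
  count := Pi.single 1 s
  sum_count := by simp

/-- The tensor product `B ⊗ B'` of two one-row crystals, as a set. -/
abbrev Tensor (n s t : ℕ) [NeZero n] : Type := Row n s × Row n t

namespace Tensor

variable {s t : ℕ}

/-- In the tensor product rule, `f_i` acts on the left factor of `b ⊗ b'` if `φ_i(b') ≤ ε_i(b)`,
and on the right factor otherwise. -/
def ActsLeft (i : ZMod n) (x : Tensor n s t) : Prop := x.2.phi i ≤ x.1.eps i

/-- The arrow `x → y` of colour `i` in the crystal graph of the tensor product, i.e. `f_i x = y`,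
equivalently `e_i y = x`. -/
def Arrow (i : ZMod n) (x y : Tensor n s t) : Prop :=
  (ActsLeft i x ∧ x.1.Arrow i y.1 ∧ y.2 = x.2) ∨ (¬ ActsLeft i x ∧ y.1 = x.1 ∧ x.2.Arrow i y.2)

/-- The weight of `b ⊗ b'`, recorded as the total number of occurrences of each letter. -/
def weight (x : Tensor n s t) : ZMod n → ℕ := fun r => x.1.count r + x.2.count r

end Tensor

/-- `R` is an isomorphism of affine crystals `B ⊗ B' → B' ⊗ B`: a bijection that preserves weights
and the arrows of all colours `i ∈ ℤ/nℤ`. -/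
def IsCrystalIso {s t : ℕ} (R : Tensor n s t ≃ Tensor n t s) : Prop :=
  (∀ x, (R x).weight = x.weight) ∧ ∀ i x y, Tensor.Arrow i x y ↔ Tensor.Arrow i (R x) (R y)

instance {s t : ℕ} : Nonempty (Tensor n s t ≃ Tensor n t s) := ⟨Equiv.prodComm _ _⟩

/-- The combinatorial `R`-matrix `B ⊗ B' → B' ⊗ B`: the (unique) isomorphism of affine crystals. -/
noncomputable def combR (n s t : ℕ) [NeZero n] : Tensor n s t ≃ Tensor n t s :=
  Classical.epsilon IsCrystalIso

open Classical in
/-- `H` is the local coenergy function of `B ⊗ B'`: it is constant along the arrows of colour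
`i ≠ 0`; along an arrow `x → y` of colour `0` (so `x = e_0 y`) its value at `x` exceeds that at `y`
by `1`, `-1` or `0` according as `e_0` acts on the left factor in both `B ⊗ B'` and `B' ⊗ B`, on the
right factor in both, or on different sides; and it vanishes at `1⋯1 ⊗ 1⋯1`. -/
def IsCoenergy {s t : ℕ} (H : Tensor n s t → ℤ) : Prop :=
  (∀ i x y, i ≠ 0 → Tensor.Arrow i x y → H x = H y) ∧
  (∀ x y, Tensor.Arrow 0 x y → H x = H y +
    (if x.ActsLeft 0 ∧ (combR n s t x).ActsLeft 0 then 1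
     else if ¬ x.ActsLeft 0 ∧ ¬ (combR n s t x).ActsLeft 0 then -1
     else 0)) ∧
  H (Row.ones n s, Row.ones n t) = 0

/-- The local coenergy function `B ⊗ B' → ℤ`: the (unique) function with the properties above. -/
noncomputable def coenergy (n s t : ℕ) [NeZero n] : Tensor n s t → ℤ :=
  Classical.epsilon IsCoenergy

variable {m : ℕ} {s : Fin m → ℕ}

/-- The factor `b_i` of `b = b_1 ⊗ ⋯ ⊗ b_m`, moved to the right past the next `k` factors by
successive combinatorial `R`-matrices.  This is the factor in position `i + k` after the
`R`-matrices on the positions `(i, i+1)`, `(i+1, i+2)`, …, `(i+k-1, i+k)` have been applied to `b`,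
in this order. -/
noncomputable def carry (b : ∀ i, Row n (s i)) (i : Fin m) : ℕ → Row n (s i)
  | 0 => b i
  | k + 1 =>
    if h : (i : ℕ) + k + 1 < m then
      (combR n (s i) (s ⟨i + k + 1, h⟩) (carry b i k, b ⟨i + k + 1, h⟩)).2
    else carry b i k

/-- The intrinsic energy of `b = b_1 ⊗ ⋯ ⊗ b_m`: the sum over `i < j` of the local coenergy of
`b_i`, moved to the position `j - 1`, with `b_j`. -/
noncomputable def intrinsicEnergy (b : ∀ i, Row n (s i)) : ℤ :=
  ∑ i, ∑ j ∈ Finset.Ioi i,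
    coenergy n (s i) (s j) (carry b i ((j : ℕ) - (i : ℕ) - 1), b j)

/-- The variable `x_k^{(c)}`, for `1 ≤ k ≤ m` and a colour `c ∈ ℤ/nℤ`: the number of letters `r`
in `b_k`, where `c = r + k - 1`. -/
def colored (b : ∀ i, Row n (s i)) (k : ℕ) (c : ZMod n) : ℕ :=
  if h : 1 ≤ k ∧ k ≤ m then (b ⟨k - 1, by omega⟩).count (c - k + 1) else 0

/-- The stretched staircase `(n-1)δ_{m-1}`, whose rows have lengths
`(n-1)(m-1), (n-1)(m-2), …, n-1`.  Rows and columns are numbered from `0`. -/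
def staircase (n m : ℕ) : YoungDiagram where
  cells := (Finset.range (m - 1) ×ˢ Finset.range ((n - 1) * (m - 1))).filter
    fun c => c.2 < (n - 1) * (m - 1 - c.1)
  isLowerSet := by
    rintro ⟨i, j⟩ ⟨i', j'⟩ ⟨hi, hj⟩ h
    simp only [Finset.coe_filter, Finset.mem_product, Finset.mem_range, Set.mem_ofPred_eq] at h ⊢
    simp only at hi hj
    have : (n - 1) * (m - 1 - i) ≤ (n - 1) * (m - 1 - i') :=
      Nat.mul_le_mul_left _ (by omega)
    omega

end KRCrystal

/-! Both sides are the lowest orders, as q → 0+, of the two sides of one subtraction-free identity.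

Energy side. For two rows, `localMin` is the minimum of the n path sums `pathSum x y r k`. Adding
differences of its values at neighbouring letters to the letter counts gives the R-matrix
(`combR_eq_swap`), and its value at the letter 0 is the coenergy (`coenergy_eq_localMin`). Both
formulas are checked along each arrow; uniqueness follows from connectedness of the crystal.
Iterated, they turn carrying b_l to the right into a min-plus recursion for a function on ℤ,
`potential`, whose increments are the letter counts of the carried row (`potential_add_one`). The
coenergies telescope, so the energy is read off from the last potentials (`intrinsicEnergy_eq`).

Tableau side. Give a cell of content c and letter k the weight y_k(c). The sum over tableaux,
written over Gelfand-Tsetlin patterns, is a determinant whose columns solve difference equations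
(`det_eq_patternSum`). For weights of period n the solutions are quasi-periodic with multipliers
X_j, and each further equation is solved by a truncated geometric series (`carrySum_sub`). For the
stretched staircase the arguments of the rows advance by n, so the determinant is a Vandermonde
determinant in the X_j times values of the solutions. The Vandermonde factor cancels the normalizing
constants up to powers of the X_j, and a product is left (`patternSum_staircase`).

With y_k(c) a positive constant times q to the letter count, all terms are positive. The pattern sum
therefore has the order of the least tableau value, while the product has the order found for the
energy (`isLeast_isPatternValue`). -/

namespace KRCrystal

/-! ### Path sums and their minima -/

/-- The minimum of `f 0, …, f d`. -/
def runMin (f : ℕ → ℤ) : ℕ → ℤ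
  | 0 => f 0
  | d + 1 => min (runMin f d) (f (d + 1))

lemma runMin_le (f : ℕ → ℤ) {d k : ℕ} (hk : k ≤ d) : runMin f d ≤ f k := by
  induction d with
  | zero => obtain rfl : k = 0 := by omega
            exact le_rfl
  | succ d ih =>
    rcases Nat.lt_or_ge d k with h | h
    · obtain rfl : k = d + 1 := by omega
      exact min_le_right _ _
    · exact (min_le_left _ _).trans (ih h)

lemma exists_runMin_eq (f : ℕ → ℤ) (d : ℕ) : ∃ k ≤ d, runMin f d = f k := by
  induction d with
  | zero => exact ⟨0, le_rfl, rfl⟩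
  | succ d ih =>
    obtain ⟨k, hk, h⟩ := ih
    rcases min_choice (runMin f d) (f (d + 1)) with h' | h'
    · exact ⟨k, by omega, h'.trans h⟩
    · exact ⟨d + 1, le_rfl, h'⟩

lemma runMin_congr {f g : ℕ → ℤ} {d : ℕ} (h : ∀ k ≤ d, f k = g k) : runMin f d = runMin g d := by
  induction d with
  | zero => exact h 0 le_rfl
  | succ d ih => rw [runMin, runMin, ih fun k hk => h k (by omega), h _ le_rfl]

lemma runMin_add_const (f : ℕ → ℤ) (c : ℤ) (d : ℕ) :
    runMin (fun k => f k + c) d = runMin f d + c := by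
  induction d with
  | zero => rfl
  | succ d ih => rw [runMin, runMin, ih, min_add_add_right]

lemma runMin_succ_eq_min_head (f : ℕ → ℤ) (d : ℕ) :
    runMin f (d + 1) = min (f 0) (runMin (fun k => f (k + 1)) d) := by
  induction d with
  | zero => rfl
  | succ d ih => rw [runMin, ih, runMin, min_assoc]

/-- Raising or lowering a value that is not below a neighbouring one does not change the minimum. -/
lemma runMin_eq_of_perturb {f g : ℕ → ℤ} {d a b : ℕ} (ha : a ≤ d) (hab : a ≠ b)
    (h : ∀ k ≤ d, k ≠ b → g k = f k) (hf : f a ≤ f b) (hg : f a ≤ g b) :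
    runMin g d = runMin f d := by
  apply le_antisymm
  · obtain ⟨k, hk, hk'⟩ := exists_runMin_eq f d
    rw [hk']
    by_cases hkb : k = b
    · subst hkb
      exact (runMin_le g ha).trans ((h a ha hab).le.trans hf)
    · exact (runMin_le g hk).trans (h k hk hkb).le
  · obtain ⟨k, hk, hk'⟩ := exists_runMin_eq g d
    rw [hk']
    by_cases hkb : k = b
    · subst hkb
      exact (runMin_le f ha).trans hg
    · exact (runMin_le f hk).trans (h k hk hkb).ge

/-- The sum of the letter counts `y (r+1), …, y (r+k)` and `x (r+k+2), …, x (r+n)`. -/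
def pathSum {n : ℕ} (x y : ZMod n → ℤ) (r : ZMod n) (k : ℕ) : ℤ :=
  ∑ l ∈ Finset.range k, y (r + 1 + l) + ∑ l ∈ Finset.Ico k (n - 1), x (r + 2 + l)

lemma pathSum_succ {n : ℕ} (x y : ZMod n → ℤ) (r : ZMod n) {k : ℕ} (hk : k + 1 < n) :
    pathSum x y r (k + 1) + x (r + 1 + k + 1) = pathSum x y r k + y (r + 1 + k) := by
  simp only [pathSum]
  rw [Finset.sum_range_succ, Finset.sum_eq_sum_Ico_succ_bot (show k < n - 1 by omega),
    show r + 1 + (k : ZMod n) + 1 = r + 2 + k by ring]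
  ring

lemma natCast_add_inj {n : ℕ} (r : ZMod n) {l l' : ℕ} (hl : l < n) (hl' : l' < n) :
    r + (l : ZMod n) = r + l' ↔ l = l' := by
  rw [add_right_inj, ZMod.natCast_eq_natCast_iff', Nat.mod_eq_of_lt hl, Nat.mod_eq_of_lt hl']

/-- The letter count after one letter `i` has become `i + 1`. -/
def shiftLetter {n : ℕ} (i : ZMod n) (x : ZMod n → ℤ) (z : ZMod n) : ℤ :=
  x z - (if z = i then 1 else 0) + (if z = i + 1 then 1 else 0)

/-- The sum takes `x` at r + k + 2, …, r + n. This range contains i + 1 but not i, where i = r + 1 +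
l, exactly when k = l; otherwise the two changes cancel or are both absent. -/
lemma pathSum_shift_left_of_ne {n : ℕ} (x y : ZMod n → ℤ) (r : ZMod n) {l k : ℕ} (hl : l + 1 < n)
    (hk : k < n) :
    pathSum (shiftLetter (r + 1 + (l : ZMod n)) x) y r k = pathSum x y r k + if k = l then 1 else 0 := by
  simp only [pathSum, shiftLetter, Finset.sum_add_distrib, Finset.sum_sub_distrib]
  have h1 : ∑ j ∈ Finset.Ico k (n - 1), (if r + 2 + (j : ZMod n) = r + 1 + l then (1 : ℤ) else 0)
      = if k + 1 ≤ l then 1 else 0 := by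
    have : ∀ j ∈ Finset.Ico k (n - 1),
        (if r + 2 + (j : ZMod n) = r + 1 + l then (1 : ℤ) else 0) = if j + 1 = l then 1 else 0 := by
      intro j hj
      rw [Finset.mem_Ico] at hj
      rw [show r + 2 + (j : ZMod n) = r + 1 + ((j + 1 : ℕ) : ZMod n) by push_cast; ring]
      simp only [natCast_add_inj (r + 1) (show j + 1 < n by omega) (show l < n by omega)]
    rw [Finset.sum_congr rfl this]
    rcases l with _ | l
    · simp
    · simp only [Nat.add_right_cancel_iff, Finset.sum_ite_eq', Finset.mem_Ico]
      congr 1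
      simp only [eq_iff_iff]
      omega
  have h2 : ∑ j ∈ Finset.Ico k (n - 1),
      (if r + 2 + (j : ZMod n) = r + 1 + l + 1 then (1 : ℤ) else 0) = if k ≤ l then 1 else 0 := by
    have : ∀ j ∈ Finset.Ico k (n - 1),
        (if r + 2 + (j : ZMod n) = r + 1 + l + 1 then (1 : ℤ) else 0) = if j = l then 1 else 0 := by
      intro j hj
      rw [Finset.mem_Ico] at hj
      rw [show r + 1 + (l : ZMod n) + 1 = r + 2 + l by ring]
      simp only [natCast_add_inj (r + 2) (show j < n by omega) (show l < n by omega)]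
    rw [Finset.sum_congr rfl this]
    simp only [Finset.sum_ite_eq', Finset.mem_Ico]
    congr 1
    simp only [eq_iff_iff]
    omega
  rw [h1, h2]
  split_ifs <;> omega

/-- The sum takes `y` at r + 1, …, r + k, a range that contains i but not i + 1 exactly when k = l +
1. -/
lemma pathSum_shift_right_of_ne {n : ℕ} (x y : ZMod n → ℤ) (r : ZMod n) {l k : ℕ} (hl : l + 1 < n)
    (hk : k < n) :
    pathSum x (shiftLetter (r + 1 + (l : ZMod n)) y) r k
      = pathSum x y r k - if k = l + 1 then 1 else 0 := by
  simp only [pathSum, shiftLetter, Finset.sum_add_distrib, Finset.sum_sub_distrib]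
  have h1 : ∑ j ∈ Finset.range k, (if r + 1 + (j : ZMod n) = r + 1 + l then (1 : ℤ) else 0)
      = if l < k then 1 else 0 := by
    have : ∀ j ∈ Finset.range k,
        (if r + 1 + (j : ZMod n) = r + 1 + l then (1 : ℤ) else 0) = if j = l then 1 else 0 := by
      intro j hj
      rw [Finset.mem_range] at hj
      simp only [natCast_add_inj (r + 1) (show j < n by omega) (show l < n by omega)]
    rw [Finset.sum_congr rfl this]
    simp
  have h2 : ∑ j ∈ Finset.range k, (if r + 1 + (j : ZMod n) = r + 1 + l + 1 then (1 : ℤ) else 0)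
      = if l + 1 < k then 1 else 0 := by
    have : ∀ j ∈ Finset.range k, (if r + 1 + (j : ZMod n) = r + 1 + l + 1 then (1 : ℤ) else 0)
        = if j = l + 1 then 1 else 0 := by
      intro j hj
      rw [Finset.mem_range] at hj
      rw [show r + 1 + (l : ZMod n) + 1 = r + 1 + ((l + 1 : ℕ) : ZMod n) by push_cast; ring]
      simp only [natCast_add_inj (r + 1) (show j < n by omega) (show l + 1 < n by omega)]
    rw [Finset.sum_congr rfl this]
    simp
  rw [h1, h2]
  split_ifs <;> omega

variable {n : ℕ} [NeZero n]

/-- The minimum of the path sums that start at the letter `r`. -/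
def localMin (x y : ZMod n → ℤ) (r : ZMod n) : ℤ := runMin (pathSum x y r) (n - 1)

lemma sum_zmod_eq_sum_range (x : ZMod n → ℤ) (r : ZMod n) :
    ∑ l ∈ Finset.range n, x (r + l) = ∑ z, x z := by
  refine Finset.sum_bij' (fun l _ => r + l) (fun z _ => (z - r).val) ?_ ?_ ?_ ?_ ?_
  · simp
  · intro z _
    simpa using ZMod.val_lt _
  · intro l hl
    simp [ZMod.val_cast_of_lt (Finset.mem_range.1 hl)]
  · intro z _
    simp
  · simp

lemma pathSum_zero (hn : 1 < n) (x y : ZMod n → ℤ) (r : ZMod n) :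
    pathSum x y r 0 = ∑ z, x z - x (r + 1) := by
  rw [← sum_zmod_eq_sum_range x (r + 1), pathSum]
  obtain ⟨N, rfl⟩ : ∃ N, n = N + 2 := ⟨n - 2, by omega⟩
  rw [Finset.sum_range_succ' _ (N + 1)]
  simp only [Finset.range_zero, Finset.sum_empty, zero_add, Nat.Ico_zero_eq_range, Nat.cast_zero,
    add_zero, add_sub_cancel_right, Nat.reduceSubDiff]
  refine Finset.sum_congr rfl fun l _ => ?_
  congr 1
  push_cast
  ring

lemma pathSum_last (hn : 1 < n) (x y : ZMod n → ℤ) (r : ZMod n) :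
    pathSum x y r (n - 1) = ∑ z, y z - y r := by
  rw [← sum_zmod_eq_sum_range y (r + 1), pathSum]
  obtain ⟨N, rfl⟩ : ∃ N, n = N + 2 := ⟨n - 2, by omega⟩
  rw [Finset.sum_range_succ _ (N + 1)]
  have : (r + 1 + ((N + 1 : ℕ) : ZMod (N + 2))) = r := by
    have := ZMod.natCast_self (N + 2)
    push_cast at this ⊢
    linear_combination this
  rw [this]
  simp

/-- Moving the start from r to r + 1 drops `y (r + 1)` at the front and appends `x (r + 1)` = `x (r
+ 1 + n)` at the end. -/
lemma pathSum_shift (x y : ZMod n → ℤ) (r : ZMod n) {k : ℕ} (hk : k + 1 < n) :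
    pathSum x y (r + 1) k + y (r + 1) = pathSum x y r (k + 1) + x (r + 1) := by
  obtain ⟨N, rfl⟩ : ∃ N, n = N + 2 := ⟨n - 2, by omega⟩
  have h1 : ∀ l : ℕ, (r + 1 + ((l + 1 : ℕ) : ZMod (N + 2))) = r + 1 + 1 + l := by
    intro l; push_cast; ring
  have h2 : ∀ l : ℕ, (r + 2 + ((l + 1 : ℕ) : ZMod (N + 2))) = r + 1 + 2 + l := by
    intro l; push_cast; ring
  have h3 : r + 1 + 2 + (N : ZMod (N + 2)) = r + 1 := by
    have := ZMod.natCast_self (N + 2)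
    push_cast at this
    linear_combination this
  simp only [pathSum, Finset.sum_range_succ', h1, Nat.add_one_sub_one]
  have h4 : ∑ l ∈ Finset.Ico (k + 1) (N + 1), x (r + 2 + l)
      = ∑ l ∈ Finset.Ico k N, x (r + 1 + 2 + l) := by
    rw [← Finset.sum_Ico_add' (fun l : ℕ => x (r + 2 + l)) k N 1]
    simp only [h2]
  rw [h4, Finset.sum_Ico_succ_top (by omega), h3]
  simp only [Nat.cast_zero, add_zero]
  ring

/-- The quantities that control `localMin` at three successive letters. -/
lemma exists_localMin_split (hn : 1 < n) (x y : ZMod n → ℤ) (i : ZMod n) :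
    ∃ A B, A = runMin (pathSum x y i) (n - 2) ∧ B = runMin (fun k => pathSum x y i (k + 1)) (n - 2) ∧
      localMin x y i = min A (∑ z, y z - y i) ∧
      localMin x y i = min (∑ z, x z - x (i + 1)) B ∧
      localMin x y (i - 1) + x i = min (A + y i) (∑ z, x z) ∧
      localMin x y (i + 1) + y (i + 1) = min (B + x (i + 1)) (∑ z, y z) ∧
      A ≤ ∑ z, x z - x (i + 1) ∧ B ≤ ∑ z, y z - y i := by
  have e : n - 1 = n - 2 + 1 := by omega
  refine ⟨_, _, rfl, rfl, ?_, ?_, ?_, ?_, ?_, ?_⟩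
  · rw [localMin, e, runMin, ← e, pathSum_last hn]
  · rw [localMin, e, runMin_succ_eq_min_head, pathSum_zero hn]
  · rw [localMin, e, runMin_succ_eq_min_head, pathSum_zero hn, ← runMin_add_const,
      min_comm, ← min_add_add_right, ← runMin_add_const]
    congr 1
    · refine runMin_congr fun k hk => ?_
      have := pathSum_shift x y (i - 1) (k := k) (by omega)
      simp only [sub_add_cancel] at this
      exact this.symm
    · simp
  · rw [localMin, e, runMin, ← e, pathSum_last hn, ← min_add_add_right, ← runMin_add_const,
      ← runMin_add_const]
    congr 1
    · refine runMin_congr fun k hk => ?_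
      exact pathSum_shift x y i (k := k) (by omega)
    · simp
  · rw [← pathSum_zero hn x y]
    exact runMin_le _ (Nat.zero_le _)
  · rw [← pathSum_last hn x y, e]
    exact runMin_le (fun k => pathSum x y i (k + 1)) le_rfl

lemma sum_shiftLetter (i : ZMod n) (x : ZMod n → ℤ) : ∑ z, shiftLetter i x z = ∑ z, x z := by
  simp [shiftLetter, Finset.sum_add_distrib]

lemma exists_natCast_add_eq (r i : ZMod n) : ∃ l < n, i = r + (l : ZMod n) :=
  ⟨(i - r).val, ZMod.val_lt _, by simp⟩

/-- Every path sum starting at i except the last contains `x i`, as x (i + n), and none contains `x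
(i + 1)`. -/
lemma pathSum_shift_left_self (hn : 1 < n) (x y : ZMod n → ℤ) (i : ZMod n) {k : ℕ}
    (hk : k + 1 < n) :
    pathSum (shiftLetter i x) y i k = pathSum x y i k - 1 := by
  have h := pathSum_shift_left_of_ne x y (i - 1) (l := 0) (k := k + 1) (by omega) hk
  have e1 := pathSum_shift (shiftLetter i x) y (i - 1) hk
  have e2 := pathSum_shift x y (i - 1) hk
  have : shiftLetter i x i = x i - 1 := by
    have := natCast_add_inj i (l := 0) (l' := 1) (by omega) hn
    simp at this
    simp [shiftLetter, this]
  simp at h e1 e2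
  omega

lemma pathSum_shift_right_self (hn : 1 < n) (x y : ZMod n → ℤ) (i : ZMod n) {k : ℕ}
    (hk : k + 1 < n) :
    pathSum x (shiftLetter i y) i (k + 1) = pathSum x y i (k + 1) + 1 := by
  have e1 := pathSum_shift x (shiftLetter i y) i hk
  have e2 := pathSum_shift x y i hk
  have e3 : pathSum x (shiftLetter i y) (i + 1) k = pathSum x y (i + 1) k := by
    have h := pathSum_shift_right_of_ne x y (i + 1) (l := n - 2) (k := k) (by omega) (by omega)
    -- Seen from i + 1, the letter i is the last one reached, at l = n - 2; its effect would be at k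
    -- = n - 1, which is out of range.
    rw [show i + 1 + 1 + ((n - 2 : ℕ) : ZMod n) = i by
      rw [Nat.cast_sub (by omega)]; push_cast; rw [ZMod.natCast_self]; ring] at h
    rw [h, if_neg (by omega), sub_zero]
  have : shiftLetter i y (i + 1) = y (i + 1) + 1 := by
    have := natCast_add_inj i (l := 1) (l' := 0) hn (by omega)
    simp at this
    simp [shiftLetter, this]
  omega

lemma exists_succ_add_of_ne {r i : ZMod n} (h : r ≠ i) : ∃ l, l + 1 < n ∧ i = r + 1 + (l : ZMod n) := by
  obtain ⟨l, hl, e⟩ := exists_natCast_add_eq (r + 1) i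
  refine ⟨l, ?_, e⟩
  by_contra hl'
  obtain rfl : n = l + 1 := by omega
  apply h
  have := ZMod.natCast_self (l + 1)
  push_cast at this
  rw [e]
  linear_combination -this

/-- Only the path sum at l rises. By `pathSum_succ` the hypothesis says that its neighbour at l + 1
is no larger, so the minimum does not see the change. -/
lemma localMin_shift_left_of_ne (x y : ZMod n → ℤ) {r i : ZMod n} (h : r ≠ i)
    (hi : y i ≤ x (i + 1)) : localMin (shiftLetter i x) y r = localMin x y r := by
  obtain ⟨l, hl, rfl⟩ := exists_succ_add_of_ne h
  have := pathSum_succ x y r hl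
  refine runMin_eq_of_perturb (a := l + 1) (b := l) (by omega) (by omega) ?_ ?_ ?_
  · intro k hk hkl
    rw [pathSum_shift_left_of_ne x y r hl (by omega), if_neg hkl, add_zero]
  · omega
  · rw [pathSum_shift_left_of_ne x y r hl (by omega), if_pos rfl]
    omega

/-- Only the path sum at l + 1 drops, by one. The strict inequality keeps it at or above its
neighbour at l. -/
lemma localMin_shift_right_of_ne (x y : ZMod n → ℤ) {r i : ZMod n} (h : r ≠ i)
    (hi : x (i + 1) < y i) : localMin x (shiftLetter i y) r = localMin x y r := by
  obtain ⟨l, hl, rfl⟩ := exists_succ_add_of_ne h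
  have := pathSum_succ x y r hl
  refine runMin_eq_of_perturb (a := l) (b := l + 1) (by omega) (by omega) ?_ ?_ ?_
  · intro k hk hkl
    rw [pathSum_shift_right_of_ne x y r hl (by omega), if_neg hkl, sub_zero]
  · omega
  · rw [pathSum_shift_right_of_ne x y r hl (by omega), if_pos rfl]
    omega

lemma localMin_shift_left_self (hn : 1 < n) (x y : ZMod n → ℤ) (i : ZMod n) :
    localMin (shiftLetter i x) y i = min (runMin (pathSum x y i) (n - 2) - 1) (∑ z, y z - y i) := by
  have e : n - 1 = n - 2 + 1 := by omega
  rw [localMin, e, runMin, ← e, pathSum_last hn, sub_eq_add_neg _ (1 : ℤ), ← runMin_add_const]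
  congr 1
  refine runMin_congr fun k hk => ?_
  rw [pathSum_shift_left_self hn x y i (by omega), sub_eq_add_neg]

lemma localMin_shift_right_self (hn : 1 < n) (x y : ZMod n → ℤ) (i : ZMod n) :
    localMin x (shiftLetter i y) i
      = min (∑ z, x z - x (i + 1)) (runMin (fun k => pathSum x y i (k + 1)) (n - 2) + 1) := by
  have e : n - 1 = n - 2 + 1 := by omega
  rw [localMin, e, runMin_succ_eq_min_head, pathSum_zero hn, ← runMin_add_const]
  congr 1
  refine runMin_congr fun k hk => ?_
  rw [pathSum_shift_right_self hn x y i (by omega)]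

end KRCrystal

/-! ### The piecewise-linear R-matrix commutes with the arrows -/

namespace KRCrystal

variable {n : ℕ} [NeZero n] {s t : ℕ}

/-- The letter counts of a one-row tableau, as integers. -/
def Row.icount (b : Row n s) (r : ZMod n) : ℤ := b.count r

lemma Row.icount_nonneg (b : Row n s) (r : ZMod n) : 0 ≤ b.icount r := Int.natCast_nonneg _

lemma Row.sum_icount (b : Row n s) : ∑ r, b.icount r = s := by
  simpa only [Row.icount, Nat.cast_sum] using congrArg (Nat.cast : ℕ → ℤ) b.sum_count

lemma Row.ext_icount {b b' : Row n s} (h : ∀ r, b.icount r = b'.icount r) : b = b' := by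
  ext r
  have := h r
  simp only [Row.icount] at this
  exact_mod_cast this

lemma Row.arrow_iff (i : ZMod n) (b b' : Row n s) :
    b.Arrow i b' ↔ b'.icount = shiftLetter i b.icount := by
  rw [funext_iff]
  refine forall_congr' fun r => ?_
  simp only [Row.icount, shiftLetter]
  split_ifs <;> omega

/-- The one-row tableau with given letter counts. -/
def Row.ofInt (f : ZMod n → ℤ) (hf : ∀ r, 0 ≤ f r) (hs : ∑ r, f r = s) : Row n s where
  count r := (f r).toNat
  sum_count := by
    zify
    rw [← hs]
    exact Finset.sum_congr rfl fun r _ => Int.toNat_of_nonneg (hf r)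

lemma Row.icount_ofInt (f : ZMod n → ℤ) (hf : ∀ r, 0 ≤ f r) (hs : ∑ r, f r = s) :
    (Row.ofInt f hf hs).icount = f :=
  funext fun r => Int.toNat_of_nonneg (hf r)

lemma Tensor.actsLeft_iff (i : ZMod n) (x : Tensor n s t) :
    x.ActsLeft i ↔ x.2.icount i ≤ x.1.icount (i + 1) := by
  simp [Tensor.ActsLeft, Row.phi, Row.eps, Row.icount]

/-- The minimum of path sums of a tensor product of two one-row tableaux. -/
def Tensor.localMin (x : Tensor n s t) (r : ZMod n) : ℤ :=
  KRCrystal.localMin x.1.icount x.2.icount r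

/-- Together with `localMin_le_left`, this makes the letter counts in `Tensor.swap` nonnegative. -/
lemma Tensor.localMin_le_right (hn : 1 < n) (x : Tensor n s t) (r : ZMod n) :
    x.localMin r ≤ x.localMin (r - 1) + x.1.icount r := by
  obtain ⟨A, B, -, -, h1, h2, h3, h4, h5, h6⟩ :=
    exists_localMin_split hn x.1.icount x.2.icount r
  have := x.2.icount_nonneg r
  have := x.1.icount_nonneg (r + 1)
  simp only [Tensor.localMin]
  omega

lemma Tensor.localMin_le_left (hn : 1 < n) (x : Tensor n s t) (r : ZMod n) :
    x.localMin (r - 1) ≤ x.localMin r + x.2.icount r := by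
  obtain ⟨A, B, -, -, h1, h2, h3, h4, h5, h6⟩ :=
    exists_localMin_split hn x.1.icount x.2.icount (r - 1)
  have := x.2.icount_nonneg (r - 1)
  have := x.1.icount_nonneg r
  simp only [sub_add_cancel] at h1 h2 h3 h4 h5 h6
  simp only [Tensor.localMin]
  omega

lemma Tensor.sum_localMin_pred (x : Tensor n s t) :
    ∑ r, x.localMin (r - 1) = ∑ r, x.localMin r :=
  Fintype.sum_equiv (Equiv.subRight 1) _ _ fun _ => rfl

/-- The combinatorial `R`-matrix by its piecewise-linear formula. -/
def Tensor.swap (hn : 1 < n) (x : Tensor n s t) : Tensor n t s :=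
  (Row.ofInt (fun r => x.2.icount r + x.localMin r - x.localMin (r - 1))
    (fun r => by have := x.localMin_le_left hn r; omega)
    (by rw [Finset.sum_sub_distrib, Finset.sum_add_distrib, x.sum_localMin_pred, Row.sum_icount]
        ring),
   Row.ofInt (fun r => x.1.icount r + x.localMin (r - 1) - x.localMin r)
    (fun r => by have := x.localMin_le_right hn r; omega)
    (by rw [Finset.sum_sub_distrib, Finset.sum_add_distrib, x.sum_localMin_pred, Row.sum_icount]
        ring))

lemma Tensor.icount_swap_fst (hn : 1 < n) (x : Tensor n s t) (r : ZMod n) :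
    (x.swap hn).1.icount r = x.2.icount r + x.localMin r - x.localMin (r - 1) := by
  rw [Tensor.swap, Row.icount_ofInt]

lemma Tensor.icount_swap_snd (hn : 1 < n) (x : Tensor n s t) (r : ZMod n) :
    (x.swap hn).2.icount r = x.1.icount r + x.localMin (r - 1) - x.localMin r := by
  rw [Tensor.swap, Row.icount_ofInt]

/-- The term `localMin i` occurs in both counts that are compared and cancels. -/
lemma Tensor.actsLeft_swap_iff (hn : 1 < n) (i : ZMod n) (x : Tensor n s t) :
    (x.swap hn).ActsLeft i ↔
      x.localMin (i - 1) + x.1.icount i ≤ x.localMin (i + 1) + x.2.icount (i + 1) := by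
  rw [Tensor.actsLeft_iff, Tensor.icount_swap_fst, Tensor.icount_swap_snd, add_sub_cancel_right]
  omega

lemma Tensor.localMin_eq_of_arrow_of_ne {x y : Tensor n s t} {i r : ZMod n}
    (h : Tensor.Arrow i x y) (hr : r ≠ i) : y.localMin r = x.localMin r := by
  rcases h with ⟨hl, h1, h2⟩ | ⟨hl, h1, h2⟩ <;> rw [Tensor.actsLeft_iff] at hl <;>
    rw [Row.arrow_iff] at * <;> simp only [Tensor.localMin]
  · rw [h2, h1, localMin_shift_left_of_ne _ _ hr hl]
  · rw [h2, h1, localMin_shift_right_of_ne _ _ hr (not_le.1 hl)]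

open Classical in
/-- The change of `localMin` along an arrow. -/
lemma Tensor.localMin_eq_of_arrow (hn : 1 < n) {x y : Tensor n s t} {i : ZMod n}
    (h : Tensor.Arrow i x y) :
    x.localMin i = y.localMin i +
      (if x.ActsLeft i ∧ (x.swap hn).ActsLeft i then 1
       else if ¬ x.ActsLeft i ∧ ¬ (x.swap hn).ActsLeft i then -1
       else 0) := by
  obtain ⟨A, B, hA, hB, h1, h2, h3, h4, h5, h6⟩ :=
    exists_localMin_split hn x.1.icount x.2.icount i
  simp only [Row.sum_icount] at h1 h2 h3 h4 h5 h6
  -- By the split, the image acts on the left iff min (A + y_i) s ≤ min (B + x_{i+1}) t; what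
  -- remains is arithmetic with minima in both cases of the tensor rule.
  have hR := Tensor.actsLeft_swap_iff hn i x
  rcases h with ⟨hl, e1, e2⟩ | ⟨hl, e1, e2⟩
  · have hl' := (Tensor.actsLeft_iff i x).1 hl
    have hy : y.localMin i = min (A - 1) (t - x.2.icount i) := by
      rw [Row.arrow_iff] at e1
      rw [Tensor.localMin, e2, e1, localMin_shift_left_self hn, ← hA, Row.sum_icount]
    simp only [hl, hR, true_and, not_true, false_and, if_false]
    simp only [Tensor.localMin] at *
    split_ifs <;> omega
  · have hl' := mt (Tensor.actsLeft_iff i x).2 hl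
    have hy : y.localMin i = min (s - x.1.icount (i + 1)) (B + 1) := by
      rw [Row.arrow_iff] at e2
      rw [Tensor.localMin, e2, e1, localMin_shift_right_self hn, ← hB, Row.sum_icount]
    simp only [hl, hR, true_and, not_false_iff, false_and, if_false]
    simp only [Tensor.localMin] at *
    split_ifs <;> omega

/-- Along an arrow of colour i only `localMin i` changes, and it enters only the counts of i and i +
1. Its change 1, -1 or 0 is exactly what moves the letter change to the factor that the tensor rule
selects in the image. -/
lemma Tensor.arrow_swap (hn : 1 < n) {x y : Tensor n s t} {i : ZMod n}
    (h : Tensor.Arrow i x y) : Tensor.Arrow i (x.swap hn) (y.swap hn) := by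
  have hH : ∀ r, x.localMin r = y.localMin r + if r = i then x.localMin i - y.localMin i else 0 := by
    intro r
    by_cases hr : r = i
    · subst hr; simp
    · simp [hr, Tensor.localMin_eq_of_arrow_of_ne h hr]
  have hH' : ∀ r, x.localMin (r - 1) = y.localMin (r - 1) +
      if r = i + 1 then x.localMin i - y.localMin i else 0 := by
    intro r
    simpa only [sub_eq_iff_eq_add] using hH (r - 1)
  have hi := Tensor.localMin_eq_of_arrow hn h
  by_cases hR : (x.swap hn).ActsLeft i
  · refine Or.inl ⟨hR, (Row.arrow_iff _ _ _).2 (funext fun r => ?_), Row.ext_icount fun r => ?_⟩ <;>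
    rcases h with ⟨hl, e1, e2⟩ | ⟨hl, e1, e2⟩ <;>
    rw [Row.arrow_iff] at * <;>
    simp only [hl, hR, not_true, not_false_iff, and_self, and_true, and_false,
      if_true, if_false] at hi <;>
    have h1 := hH r <;> have h2 := hH' r <;>
    simp only [shiftLetter, Tensor.icount_swap_fst, Tensor.icount_swap_snd, e1, e2] <;>
    split_ifs at h1 h2 ⊢ <;> omega
  · refine Or.inr ⟨hR, Row.ext_icount fun r => ?_, (Row.arrow_iff _ _ _).2 (funext fun r => ?_)⟩ <;>
    rcases h with ⟨hl, e1, e2⟩ | ⟨hl, e1, e2⟩ <;>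
    rw [Row.arrow_iff] at * <;>
    simp only [hl, hR, not_true, not_false_iff, and_self, and_true, and_false,
      if_true, if_false] at hi <;>
    have h1 := hH r <;> have h2 := hH' r <;>
    simp only [shiftLetter, Tensor.icount_swap_fst, Tensor.icount_swap_snd, e1, e2] <;>
    split_ifs at h1 h2 ⊢ <;> omega

/-! ### Connectedness; uniqueness of the R-matrix and of the coenergy -/

/-- The top element of the tensor product. -/
def Tensor.ones (n s t : ℕ) [NeZero n] : Tensor n s t := (Row.ones n s, Row.ones n t)

/-- This weight allows no letter but 1. The lengths are exchanged on the right because the lemma is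
applied to images of the R-matrix. -/
lemma Tensor.eq_ones_of_weight {x : Tensor n s t} (h : x.weight = (Tensor.ones n t s).weight) :
    x = Tensor.ones n s t := by
  have h0 : ∀ r, r ≠ 1 → x.1.count r = 0 ∧ x.2.count r = 0 := by
    intro r hr
    have := congrFun h r
    simp [Tensor.weight, Tensor.ones, Row.ones, hr] at this
    exact this
  have h1 := x.1.sum_count
  have h2 := x.2.sum_count
  rw [Finset.sum_eq_single 1 (fun r _ hr => (h0 r hr).1) (by simp)] at h1
  rw [Finset.sum_eq_single 1 (fun r _ hr => (h0 r hr).2) (by simp)] at h2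
  refine Prod.ext (Row.ext (funext fun r => ?_)) (Row.ext (funext fun r => ?_)) <;>
    by_cases hr : r = 1
  · subst hr; simp [Tensor.ones, Row.ones, h1]
  · simp [Tensor.ones, Row.ones, hr, h0 r hr]
  · subst hr; simp [Tensor.ones, Row.ones, h2]
  · simp [Tensor.ones, Row.ones, hr, h0 r hr]

lemma Tensor.weight_swap (hn : 1 < n) (x : Tensor n s t) : (x.swap hn).weight = x.weight := by
  funext r
  have h1 := x.icount_swap_fst hn r
  have h2 := x.icount_swap_snd hn r
  simp only [Row.icount] at h1 h2
  simp only [Tensor.weight]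
  omega

lemma Tensor.swap_ones (hn : 1 < n) : (Tensor.ones n s t).swap hn = Tensor.ones n t s :=
  Tensor.eq_ones_of_weight (Tensor.weight_swap hn _)

lemma Row.arrow_right_unique {i : ZMod n} {b b' b'' : Row n s} (h : b.Arrow i b')
    (h' : b.Arrow i b'') : b' = b'' := by
  ext r
  have := h r
  have := h' r
  omega

lemma Row.arrow_left_unique {i : ZMod n} {b b' b'' : Row n s} (h : b'.Arrow i b)
    (h' : b''.Arrow i b) : b' = b'' := by
  ext r
  have := h r
  have := h' r
  omega

lemma Tensor.arrow_right_unique {i : ZMod n} {x y z : Tensor n s t} (h : Tensor.Arrow i x y)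
    (h' : Tensor.Arrow i x z) : y = z := by
  rcases h with ⟨hl, e1, e2⟩ | ⟨hl, e1, e2⟩ <;> rcases h' with ⟨hl', e1', e2'⟩ | ⟨hl', e1', e2'⟩
  · exact Prod.ext (Row.arrow_right_unique e1 e1') (e2.trans e2'.symm)
  · exact absurd hl hl'
  · exact absurd hl' hl
  · exact Prod.ext (e1.trans e1'.symm) (Row.arrow_right_unique e2 e2')

/-- Two preimages in different factors would give φ_i(c) < ε_i(b) and φ_i(c) ≥ ε_i(b) for the common
target b ⊗ c. This needs i ≠ i + 1, hence n > 1. -/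
lemma Tensor.arrow_left_unique (hn : 1 < n) {i : ZMod n} {x y z : Tensor n s t}
    (h : Tensor.Arrow i y x) (h' : Tensor.Arrow i z x) : y = z := by
  have hne : i + 1 ≠ i := by
    have := natCast_add_inj i (l := 1) (l' := 0) hn (by omega)
    simpa using this
  rcases h with ⟨hl, e1, e2⟩ | ⟨hl, e1, e2⟩ <;> rcases h' with ⟨hl', e1', e2'⟩ | ⟨hl', e1', e2'⟩
  · exact Prod.ext (Row.arrow_left_unique e1 e1') (e2.symm.trans e2')
  · exfalso
    have a := e1 (i + 1)
    have b := e2' i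
    simp only [Tensor.ActsLeft, Row.phi, Row.eps] at hl hl'
    rw [← e2] at hl
    rw [← e1'] at hl'
    simp [hne, hne.symm] at a b
    omega
  · exfalso
    have a := e1' (i + 1)
    have b := e2 i
    simp only [Tensor.ActsLeft, Row.phi, Row.eps] at hl hl'
    rw [← e2'] at hl'
    rw [← e1] at hl
    simp [hne, hne.symm] at a b
    omega
  · exact Prod.ext (e1.symm.trans e1') (Row.arrow_left_unique e2 e2')

/-- Changing a letter `i` into `i + 1`. -/
lemma Row.exists_arrow_right {i : ZMod n} {b : Row n s} (h : 0 < b.count i) :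
    ∃ b', b.Arrow i b' := by
  refine ⟨Row.ofInt (shiftLetter i b.icount) (fun r => ?_) ?_, ?_⟩
  · have h0 := b.icount_nonneg r
    simp only [shiftLetter]
    by_cases hr : r = i
    · subst hr
      have : 0 < b.icount r := by simpa [Row.icount] using h
      split_ifs <;> omega
    · split_ifs <;> omega
  · rw [sum_shiftLetter, Row.sum_icount]
  · rw [Row.arrow_iff, Row.icount_ofInt]

lemma Row.exists_arrow_left {i : ZMod n} {b : Row n s} (h : 0 < b.count (i + 1)) :
    ∃ b', Row.Arrow i b' b := by
  refine ⟨Row.ofInt (fun z => b.icount z + (if z = i then 1 else 0) - (if z = i + 1 then 1 else 0))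
    (fun r => ?_) ?_, ?_⟩
  · have h0 := b.icount_nonneg r
    by_cases hr : r = i + 1
    · subst hr
      have : 0 < b.icount (i + 1) := by simpa [Row.icount] using h
      split_ifs <;> omega
    · split_ifs <;> omega
  · simp [Finset.sum_add_distrib, Row.sum_icount]
  · rw [Row.arrow_iff, Row.icount_ofInt]
    funext r
    simp only [shiftLetter]
    ring

lemma Row.sum_mul_count_of_arrow (g : ZMod n → ℕ) {i : ZMod n} {b b' : Row n s}
    (h : b.Arrow i b') :
    ∑ r, g r * b'.count r + g i = ∑ r, g r * b.count r + g (i + 1) := by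
  have : ∑ r, g r * (b'.count r + if r = i then 1 else 0)
      = ∑ r, g r * (b.count r + if r = i + 1 then 1 else 0) :=
    Finset.sum_congr rfl fun r _ => by rw [h r]
  simpa [mul_add, Finset.sum_add_distrib] using this

lemma Row.eq_ones (b : Row n s) (h : ∀ r, r ≠ 1 → b.count r = 0) : b = Row.ones n s := by
  have h1 := b.sum_count
  rw [Finset.sum_eq_single 1 (fun r _ hr => h r hr) (by simp)] at h1
  refine Row.ext (funext fun r => ?_)
  by_cases hr : r = 1
  · subst hr; simp [Row.ones, h1]
  · simp [Row.ones, hr, h r hr]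

lemma val_pred_add_one {z : ZMod n} (hz : z ≠ 0) : (z - 1).val + 1 = z.val := by
  have h0 : 0 < z.val := Nat.pos_of_ne_zero fun h => hz ((ZMod.val_eq_zero z).1 h)
  have : z - 1 = ((z.val - 1 : ℕ) : ZMod n) := by
    rw [Nat.cast_sub (by omega)]; simp
  rw [this, ZMod.val_cast_of_lt (by have := ZMod.val_lt z; omega)]
  omega

/-- A property that is transported both ways along arrows and holds at the top element holds
everywhere: the crystal is connected. -/
lemma Tensor.connected_induction (hn : 1 < n) (p : Tensor n s t → Prop)
    (hp : ∀ i x y, Tensor.Arrow i x y → (p x ↔ p y)) (h1 : p (Tensor.ones n s t))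
    (x : Tensor n s t) : p x := by
  -- If the right factor has only 1's, f_r with r ≠ 1 acts on the left. Raising letters cyclically
  -- until all are 1, with colour 0 allowed, lowers this distance to the top element.
  have hA : ∀ (N : ℕ) (b : Row n s), ∑ r, (1 - r).val * b.count r = N → p (b, Row.ones n t) := by
    intro N
    induction N using Nat.strong_induction_on with
    | _ N ih =>
      intro b hb
      by_cases hr : ∀ r, r ≠ 1 → b.count r = 0
      · rw [b.eq_ones hr]; exact h1
      · push Not at hr
        obtain ⟨r, hr1, hr⟩ := hr
        obtain ⟨b', hb'⟩ := Row.exists_arrow_right (Nat.pos_of_ne_zero hr)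
        have hs := Row.sum_mul_count_of_arrow (fun r => (1 - r).val) hb'
        have hv := val_pred_add_one (z := 1 - r) (sub_ne_zero.2 hr1.symm)
        rw [show 1 - r - 1 = 1 - (r + 1) by ring] at hv
        refine (hp r (b, Row.ones n t) (b', Row.ones n t) (Or.inl ⟨?_, hb', rfl⟩)).2 (ih _ ?_ b' rfl)
        · simp [Tensor.ActsLeft, Row.phi, Row.ones, hr1]
        · omega
  -- In general, apply e_i with i ≠ 0 while the right factor has a letter i + 1 ≠ 1. Whichever
  -- factor e_i acts on, this total drops by one, until `hA` applies.
  have hB : ∀ (N : ℕ) (x : Tensor n s t),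
      ∑ r, (r - 1).val * x.1.count r + ∑ r, (r - 1).val * x.2.count r = N → p x := by
    intro N
    induction N using Nat.strong_induction_on with
    | _ N ih =>
      rintro ⟨b, c⟩ hb
      simp only at hb
      by_cases hr : ∀ r, r ≠ 1 → c.count r = 0
      · rw [c.eq_ones hr]; exact hA _ b rfl
      · push Not at hr
        obtain ⟨r, hr1, hr⟩ := hr
        obtain ⟨i, rfl⟩ : ∃ i, r = i + 1 := ⟨r - 1, by ring⟩
        have hi : i ≠ 0 := by rintro rfl; simp at hr1
        have hne : i + 1 ≠ i := by
          have := natCast_add_inj i (l := 1) (l' := 0) hn (by omega)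
          simpa using this
        have hv := val_pred_add_one hi
        by_cases hl : c.count i < b.count (i + 1)
        · obtain ⟨b', hb'⟩ := Row.exists_arrow_left (i := i) (b := b) (by omega)
          have hs := Row.sum_mul_count_of_arrow (fun r => (r - 1).val) hb'
          simp only [add_sub_cancel_right] at hs
          refine (hp i (b', c) (b, c) (Or.inl ⟨?_, hb', rfl⟩)).1 (ih _ ?_ (b', c) rfl)
          · have := hb' (i + 1)
            simp only [hne, if_true, if_false] at this
            simp only [Tensor.ActsLeft, Row.phi, Row.eps]
            omega
          · simp only
            omega
        · obtain ⟨c', hc'⟩ := Row.exists_arrow_left (i := i) (b := c) (by omega)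
          have hs := Row.sum_mul_count_of_arrow (fun r => (r - 1).val) hc'
          simp only [add_sub_cancel_right] at hs
          refine (hp i (b, c') (b, c) (Or.inr ⟨?_, rfl, hc'⟩)).1 (ih _ ?_ (b, c') rfl)
          · have := hc' i
            simp only [hne.symm, if_true, if_false] at this
            simp only [Tensor.ActsLeft, Row.phi, Row.eps]
            omega
          · simp only
            omega
  exact hB _ x rfl

/-- The double swap preserves arrows and fixes the top element; arrows determine their ends in both
directions, so connectedness spreads the equality. -/
lemma Tensor.swap_swap (hn : 1 < n) (x : Tensor n s t) : (x.swap hn).swap hn = x := by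
  refine Tensor.connected_induction hn (fun x => (x.swap hn).swap hn = x) ?_ ?_ x
  · intro i x y h
    have h' := Tensor.arrow_swap hn (Tensor.arrow_swap hn h)
    constructor
    · intro e
      rw [e] at h'
      exact Tensor.arrow_right_unique h' h
    · intro e
      rw [e] at h'
      exact Tensor.arrow_left_unique hn h' h
  · simp only [Tensor.swap_ones]

lemma exists_isCrystalIso (hn : 1 < n) :
    ∃ R : Tensor n s t ≃ Tensor n t s, IsCrystalIso R := by
  refine ⟨⟨fun x => x.swap hn, fun x => x.swap hn, Tensor.swap_swap hn, Tensor.swap_swap hn⟩,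
    ⟨Tensor.weight_swap hn, fun i x y => ⟨Tensor.arrow_swap hn, fun h => ?_⟩⟩⟩
  simpa [Tensor.swap_swap] using Tensor.arrow_swap hn h

lemma IsCrystalIso.eq_swap (hn : 1 < n) {R : Tensor n s t ≃ Tensor n t s} (hR : IsCrystalIso R)
    (x : Tensor n s t) : R x = x.swap hn := by
  refine Tensor.connected_induction hn (fun x => R x = x.swap hn) ?_ ?_ x
  · intro i x y h
    have h1 := (hR.2 i x y).1 h
    have h2 := Tensor.arrow_swap hn h
    constructor
    · intro e
      rw [e] at h1
      exact Tensor.arrow_right_unique h1 h2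
    · intro e
      rw [e] at h1
      exact Tensor.arrow_left_unique hn h1 h2
  · simp only [Tensor.swap_ones]
    exact Tensor.eq_ones_of_weight (hR.1 _)

/-- The combinatorial `R`-matrix is given by the piecewise-linear formula. -/
theorem combR_eq_swap (hn : 1 < n) (x : Tensor n s t) : combR n s t x = x.swap hn := by
  obtain ⟨R, hR⟩ := exists_isCrystalIso (s := s) (t := t) hn
  exact (Classical.epsilon_spec (p := IsCrystalIso) ⟨R, hR⟩).eq_swap hn x

lemma Tensor.localMin_ones (hn : 1 < n) : (Tensor.ones n s t).localMin 0 = 0 := by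
  obtain ⟨A, B, -, -, h1, h2, h3, h4, h5, h6⟩ :=
    exists_localMin_split hn (Tensor.ones n s t).1.icount (Tensor.ones n s t).2.icount 0
  have ht : (Tensor.ones n s t).1.icount 1 = s := by simp [Tensor.ones, Row.ones, Row.icount]
  rw [zero_add, ht, Row.sum_icount] at h2
  have hB : (0 : ℤ) ≤ Tensor.localMin (Tensor.ones n s t) 0 := by
    obtain ⟨k, -, hk⟩ := exists_runMin_eq
      (pathSum (Tensor.ones n s t).1.icount (Tensor.ones n s t).2.icount 0) (n - 1)
    rw [Tensor.localMin, KRCrystal.localMin, hk]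
    exact add_nonneg (Finset.sum_nonneg fun _ _ => Row.icount_nonneg _ _)
      (Finset.sum_nonneg fun _ _ => Row.icount_nonneg _ _)
  simp only [Tensor.localMin] at *
  omega

lemma isCoenergy_localMin (hn : 1 < n) :
    IsCoenergy (fun x : Tensor n s t => x.localMin 0) := by
  refine ⟨fun i x y hi h => (Tensor.localMin_eq_of_arrow_of_ne h hi.symm).symm, fun x y h => ?_,
    Tensor.localMin_ones hn⟩
  rw [combR_eq_swap hn]
  exact Tensor.localMin_eq_of_arrow hn h

/-- The local coenergy is a minimum of path sums. -/
theorem coenergy_eq_localMin (hn : 1 < n) (x : Tensor n s t) : coenergy n s t x = x.localMin 0 := by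
  have hL := isCoenergy_localMin (s := s) (t := t) hn
  have hC : IsCoenergy (coenergy n s t) := Classical.epsilon_spec (p := IsCoenergy) ⟨_, hL⟩
  refine Tensor.connected_induction hn (fun x => coenergy n s t x = x.localMin 0) ?_ ?_ x
  · intro i x y h
    by_cases hi : i = 0
    · subst hi
      have h1 := hC.2.1 x y h
      have h2 := hL.2.1 x y h
      simp only at h2
      omega
    · have h1 := hC.1 i x y hi h
      have h2 := hL.1 i x y hi h
      simp only at h2
      omega
  · exact hC.2.2.trans (Tensor.localMin_ones hn).symm

end KRCrystal

/-! ### The bialternant formula for pattern sums -/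

namespace KRCrystal

open Finset

section Field

variable {K : Type*} [Field K]

lemma sum_Ioc_sub_pred (g : ℤ → K) {a b : ℤ} (h : a ≤ b) :
    ∑ c ∈ Ioc a b, (g c - g (c - 1)) = g b - g a := by
  induction b, h using Int.leInduction with
  | base => simp
  | succ b hb ih =>
    have : Ioc a (b + 1) = insert (b + 1) (Ioc a b) := by
      ext c; simp only [mem_Ioc, mem_insert]; omega
    rw [this, sum_insert (by simp), ih, add_sub_cancel_right]
    ring

lemma prod_Ico_mul_eq {w y : ℤ → K} (hy : ∀ c, w (c + 1) = y c * w c) {a b : ℤ} (h : a ≤ b) :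
    (∏ c ∈ Ico a b, y c) * w a = w b := by
  induction b, h using Int.leInduction with
  | base => simp
  | succ b hb ih =>
    have : Ico a (b + 1) = insert b (Ico a b) := by
      ext c; simp only [mem_Ico, mem_insert]; omega
    rw [this, prod_insert (by simp), mul_assoc, ih, hy]

/-- A determinant whose first column solves a first-order recurrence is a sum over interlacing
sequences of determinants of smaller size. -/
lemma det_eq_sum_interlacing {m : ℕ} {w y : ℤ → K} (hw : ∀ c, w c ≠ 0)
    (hy : ∀ c, w (c + 1) = y c * w c) (u : Fin m → ℤ → K) {a : Fin (m + 1) → ℤ} (ha : Monotone a)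
    {M : Matrix (Fin (m + 1)) (Fin (m + 1)) K} (hM0 : ∀ i, M i 0 = w (a i))
    (hM : ∀ i j, M i (Fin.succ j) = u j (a i)) :
    M.det = w (a 0) * ∑ b ∈ Fintype.piFinset fun i : Fin m => Ioc (a i.castSucc) (a i.succ),
      (∏ i, w (a i.succ) / w (b i)) *
        (Matrix.of fun i j => u j (b i) - y (b i - 1) * u j (b i - 1)).det := by
  -- Dividing row i by `w (a i)` makes the first column constant; subtracting from each row its
  -- predecessor then leaves one nonzero entry there.
  let G : Matrix (Fin (m + 1)) (Fin (m + 1)) K := Matrix.of fun i j => M i j / w (a i)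
  have hG : M.det = (∏ i, w (a i)) * G.det := by
    rw [← Matrix.det_mul_column]
    congr 1
    ext i j
    simp only [G, Matrix.of_apply]
    rw [mul_div_cancel₀ _ (hw _)]
  let B : Matrix (Fin (m + 1)) (Fin (m + 1)) K :=
    Matrix.of (Fin.cons (G 0) fun i j => G i.succ j - G i.castSucc j)
  have hB : G.det = B.det :=
    Matrix.det_eq_of_forall_row_eq_smul_add_pred (fun _ => 1) (fun j => rfl)
      fun i j => by simp [B]
  have hB0 : B.det = (B.submatrix Fin.succ Fin.succ).det := by
    rw [Matrix.det_succ_column_zero, Finset.sum_eq_single 0]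
    · simp [B, G, hM0, hw]
    · intro i _ hi
      obtain ⟨i, rfl⟩ := Fin.exists_succ_eq.2 hi
      simp [B, G, hM0, hw]
    · simp
  -- Each difference of consecutive rows telescopes over the integers between a_i and a_{i+1}, so
  -- multilinearity expands the determinant over interlacing sequences.
  have hrow : B.submatrix Fin.succ Fin.succ = fun i : Fin m =>
      ∑ c ∈ Ioc (a i.castSucc) (a i.succ),
        (w c)⁻¹ • fun j : Fin m => u j c - y (c - 1) * u j (c - 1) := by
    funext i j
    have := sum_Ioc_sub_pred (fun c => u j c / w c) (ha (Fin.castSucc_lt_succ (i := i)).le)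
    simp only [B, G, Matrix.submatrix_apply, Matrix.of_apply, Fin.cons_succ, hM, Finset.sum_apply,
      Pi.smul_apply, smul_eq_mul]
    rw [← this]
    refine Finset.sum_congr rfl fun c _ => ?_
    have hc := hy (c - 1)
    rw [sub_add_cancel] at hc
    have h1 := hw c
    have h2 := hw (c - 1)
    rw [hc] at h1 ⊢
    have h3 := left_ne_zero_of_mul h1
    field_simp
  rw [hG, hB, hB0, Fin.prod_univ_succ, mul_assoc]
  congr 1
  have := (Matrix.detRowAlternating (n := Fin m) (R := K)).toMultilinearMap.map_sum_finset
    (fun _ c => (w c)⁻¹ • fun j : Fin m => u j c - y (c - 1) * u j (c - 1))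
    (fun i : Fin m => Ioc (a i.castSucc) (a i.succ))
  have hdet : (B.submatrix Fin.succ Fin.succ).det = _ := (congrArg Matrix.det hrow).trans this
  rw [hdet, Finset.mul_sum]
  refine Finset.sum_congr rfl fun b _ => ?_
  have h := Matrix.det_mul_column (fun i => (w (b i))⁻¹)
    (Matrix.of fun i j : Fin m => u j (b i) - y (b i - 1) * u j (b i - 1))
  simp only [Matrix.of_apply] at h
  simp only [div_eq_mul_inv]
  rw [Finset.prod_mul_distrib, mul_assoc, ← h]
  rfl

/-- The weighted sum over the Gelfand-Tsetlin patterns with top row `a`.  The row of the pattern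
with `m` entries and the row below it determine the cells that hold the letter `m - 1`; a cell with
content `c` and letter `k` has weight `y k c`. -/
noncomputable def patternSum (y : ℕ → ℤ → K) : (m : ℕ) → (Fin m → ℤ) → K
  | 0, _ => 1
  | m + 1, a => (∏ c ∈ Ico (-(m : ℤ)) (a 0), y m c) *
      ∑ b ∈ Fintype.piFinset fun i : Fin m => Ioc (a i.castSucc) (a i.succ),
        (∏ i, ∏ c ∈ Ico (b i) (a i.succ), y m c) * patternSum y m b

/-- Bounds satisfied by an interlacing sequence. -/
lemma strictMono_of_mem_interlacing {m : ℕ} {a : Fin (m + 1) → ℤ} (ha : StrictMono a)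
    (h0 : ∀ i, -(m : ℤ) ≤ a i) {b : Fin m → ℤ}
    (hb : b ∈ Fintype.piFinset fun i : Fin m => Ioc (a i.castSucc) (a i.succ)) :
    StrictMono b ∧ ∀ i, 1 - (m : ℤ) ≤ b i := by
  simp only [Fintype.mem_piFinset, mem_Ioc] at hb
  refine ⟨fun i j hij => ?_, fun i => ?_⟩
  · have h1 : a i.succ ≤ a j.castSucc := ha.monotone (by
      rw [Fin.le_def]; simp only [Fin.val_succ, Fin.val_castSucc]; exact hij)
    have := hb i
    have := hb j
    omega
  · have := hb i
    have := h0 i.castSucc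
    omega

/-- The bialternant formula: if `v m 0, …, v m (m - 1)` are solutions of a factorized recurrence,
their minors enumerate Gelfand-Tsetlin patterns. -/
theorem det_eq_patternSum {y : ℕ → ℤ → K} {v : ℕ → ℕ → ℤ → K}
    (hne : ∀ j c, v (j + 1) j c ≠ 0) (hrec : ∀ j c, v (j + 1) j (c + 1) = y j c * v (j + 1) j c)
    (hone : ∀ j : ℕ, v (j + 1) j (-j) = 1)
    {M : ℕ} (hstep : ∀ m j c, j < m → m < M →
      v (m + 1) j c - y m (c - 1) * v (m + 1) j (c - 1) = v m j c)
    {m : ℕ} (hm : m ≤ M) (a : Fin m → ℤ) (ha : StrictMono a) (h0 : ∀ i, 1 - (m : ℤ) ≤ a i) :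
    (Matrix.of fun i j : Fin m => v m (m - 1 - j) (a i)).det = patternSum y m a := by
  induction m with
  | zero => simp [patternSum]
  | succ m ih =>
    have h0' : ∀ i, -(m : ℤ) ≤ a i := fun i => by have := h0 i; push_cast at this; omega
    -- The columns are in reverse order of letters, so the first one belongs to the largest letter
    -- m; by `hstep` its difference operator turns the other columns into those for m letters.
    rw [det_eq_sum_interlacing (hne m) (hrec m) (fun (j : Fin m) => v (m + 1) (m - 1 - j))
      ha.monotone (fun i => by simp) (fun i j => by
        simp only [Matrix.of_apply, Fin.val_succ]
        congr 1
        omega), patternSum]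
    have e := prod_Ico_mul_eq (hrec m) (h0' 0)
    rw [hone, mul_one] at e
    rw [e]
    congr 1
    refine Finset.sum_congr rfl fun b hb => ?_
    obtain ⟨hb1, hb2⟩ := strictMono_of_mem_interlacing ha h0' hb
    rw [← ih (by omega) b hb1 hb2]
    congr 1
    · refine Finset.prod_congr rfl fun i _ => ?_
      have := (mem_Ioc.1 (Fintype.mem_piFinset.1 hb i)).2
      rw [← prod_Ico_mul_eq (hrec m) this, mul_div_cancel_right₀ _ (hne m _)]
    · congr 1
      ext i j
      simp only [Matrix.of_apply]
      exact hstep m _ _ (by omega) (by omega)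

/-! ### Quasi-periodic solutions and the stretched staircase -/

/-- The sum over paths that pass through at most `n - 1` consecutive values of `y` before `u`. -/
def carrySum (n : ℕ) (y u : ℤ → K) (c : ℤ) : K :=
  ∑ i ∈ range n, (∏ l ∈ range i, y (c - 1 - l)) * u (c - i)

/-- A truncated geometric series inverts the difference operator up to a scalar: the sum telescopes
to u(c) - Y u(c - n), and u(c - n) = u(c) / X. -/
lemma carrySum_sub {n : ℕ} {y u : ℤ → K} {X Y : K} (hX : X ≠ 0)
    (hy : ∀ c, ∏ l ∈ range n, y (c - 1 - l) = Y) (hu : ∀ c, u (c + n) = X * u c) (c : ℤ) :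
    carrySum n y u c - y (c - 1) * carrySum n y u (c - 1) = (1 - Y / X) * u c := by
  let f : ℕ → K := fun i => (∏ l ∈ range i, y (c - 1 - l)) * u (c - i)
  have h1 : y (c - 1) * carrySum n y u (c - 1) = ∑ i ∈ range n, f (i + 1) := by
    rw [carrySum, Finset.mul_sum]
    refine Finset.sum_congr rfl fun i _ => ?_
    simp only [f]
    have e1 : ∀ l : ℕ, c - 1 - 1 - (l : ℤ) = c - 1 - ((l + 1 : ℕ) : ℤ) := fun l => by
      push_cast; ring
    have e2 : c - 1 - (i : ℤ) = c - ((i + 1 : ℕ) : ℤ) := by push_cast; ring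
    simp only [Finset.prod_range_succ' (fun l : ℕ => y (c - 1 - l)), e1, e2, Nat.cast_zero,
      sub_zero]
    ring
  have h2 : carrySum n y u c = ∑ i ∈ range n, f i := rfl
  rw [h1, h2, ← Finset.sum_sub_distrib, Finset.sum_range_sub']
  have h3 : u c = X * u (c - n) := by rw [← hu, sub_add_cancel]
  simp only [f, hy, Finset.range_zero, Finset.prod_empty, Nat.cast_zero, sub_zero, one_mul]
  rw [h3]
  field_simp

lemma carrySum_add_period {n : ℕ} {y u : ℤ → K} {X : K} (hy : ∀ c, y (c + n) = y c)
    (hu : ∀ c, u (c + n) = X * u c) (c : ℤ) :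
    carrySum n y u (c + n) = X * carrySum n y u c := by
  rw [carrySum, carrySum, Finset.mul_sum]
  refine Finset.sum_congr rfl fun i _ => ?_
  rw [show c + n - i = c - i + n by ring, hu]
  have : ∀ l : ℕ, y (c + n - 1 - l) = y (c - 1 - l) := fun l => by
    rw [show c + n - 1 - (l : ℤ) = c - 1 - l + n by ring, hy]
  simp only [this]
  ring

/-- The solution `w j` of the recurrence of the letter `j`, carried past the next letters. -/
def carrySol (n : ℕ) (y w : ℕ → ℤ → K) (j : ℕ) : ℕ → ℤ → K
  | 0 => w j
  | d + 1 => carrySum n (y (j + d + 1)) (carrySol n y w j d)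

lemma carrySol_add_period {n : ℕ} {y w : ℕ → ℤ → K} {X : ℕ → K} (hy : ∀ j c, y j (c + n) = y j c)
    (hw : ∀ j c, w j (c + n) = X j * w j c) (j d : ℕ) (c : ℤ) :
    carrySol n y w j d (c + n) = X j * carrySol n y w j d c := by
  induction d generalizing c with
  | zero => exact hw j c
  | succ d ih => exact carrySum_add_period (hy _) ih c

lemma prod_vandermonde_rev (X : ℕ → K) (m : ℕ) :
    ∏ i : Fin m, ∏ j ∈ Ioi i, (X (m - 1 - j) - X (m - 1 - i))
      = ∏ l ∈ range m, ∏ k ∈ Ioo l m, (X l - X k) := by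
  rw [Finset.prod_sigma', Finset.prod_sigma']
  refine Finset.prod_bij' (fun p _ => ⟨m - 1 - p.2, m - 1 - p.1⟩)
    (fun p hp => ⟨⟨m - 1 - p.2, ?_⟩, ⟨m - 1 - p.1, ?_⟩⟩) ?_ ?_ ?_ ?_ ?_
  · simp only [mem_sigma, mem_range, mem_Ioo] at hp; omega
  · simp only [mem_sigma, mem_range, mem_Ioo] at hp; omega
  · rintro ⟨i, j⟩ h
    simp only [mem_sigma, mem_univ, mem_Ioi, true_and, Fin.lt_def] at h
    simp only [mem_sigma, mem_range, mem_Ioo]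
    omega
  · rintro ⟨l, k⟩ h
    simp only [mem_sigma, mem_range, mem_Ioo] at h
    simp only [mem_sigma, mem_univ, mem_Ioi, true_and, Fin.lt_def]
    omega
  · rintro ⟨i, j⟩ h
    simp only [Sigma.mk.injEq, heq_eq_eq, Fin.ext_iff]
    omega
  · rintro ⟨l, k⟩ h
    simp only [mem_sigma, mem_range, mem_Ioo] at h
    simp only [Sigma.mk.injEq, heq_eq_eq]
    omega
  · rintro ⟨i, j⟩ h
    rfl

/-- The pattern sum of a stretched staircase factors into carried solutions. -/
theorem patternSum_staircase {n : ℕ} (hn : 1 < n) {y w : ℕ → ℤ → K} {X : ℕ → K}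
    (hX : ∀ j, X j ≠ 0) {m : ℕ} (hXX : ∀ j k, j < k → k < m → X k ≠ X j) (hw : ∀ j c, w j c ≠ 0)
    (hwy : ∀ j c, w j (c + 1) = y j c * w j c) (hw1 : ∀ j : ℕ, w j (-j) = 1)
    (hy : ∀ j c, y j (c + n) = y j c) (hyX : ∀ j c, ∏ l ∈ range n, y j (c - 1 - l) = X j)
    (hwX : ∀ j c, w j (c + n) = X j * w j c) :
    patternSum y m (fun i => (n : ℤ) * i + (1 - m))
      = ∏ l ∈ range m, X l ^ (m - 1 - l) * carrySol n y w l (m - 1 - l) (1 - m) := by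
  -- The denominators absorb the scalars 1 - X_k / X_j from `carrySum_sub`, so that `hstep` holds
  -- exactly.
  let v : ℕ → ℕ → ℤ → K := fun m j c =>
    carrySol n y w j (m - 1 - j) c / ∏ k ∈ Ioo j m, (1 - X k / X j)
  have hv0 : ∀ j, v (j + 1) j = w j := by
    intro j
    funext c
    have : Ioo j (j + 1) = ∅ := by ext; simp
    simp [v, this, carrySol]
  have hvp : ∀ m j c, v m j (c + n) = X j * v m j c := by
    intro m j c
    simp only [v, carrySol_add_period hy hwX, mul_div_assoc]
  have hne : ∀ j k, j < k → k < m → 1 - X k / X j ≠ 0 := by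
    intro j k h hk e
    apply hXX j k h hk
    rw [sub_eq_zero, eq_comm, div_eq_one_iff_eq (hX j)] at e
    exact e
  have hstep : ∀ k j c, j < k → k < m →
      v (k + 1) j c - y k (c - 1) * v (k + 1) j (c - 1) = v k j c := by
    intro k j c hj hk
    obtain ⟨d, rfl⟩ : ∃ d, k = j + d + 1 := ⟨k - 1 - j, by omega⟩
    have hI : Ioo j (j + d + 1 + 1) = insert (j + d + 1) (Ioo j (j + d + 1)) := by
      ext c; simp only [mem_Ioo, mem_insert]; omega
    have h := carrySum_sub (hX j) (hyX (j + d + 1)) (carrySol_add_period hy hwX j d) c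
    simp only [v, hI]
    rw [prod_insert (by simp), show j + d + 1 + 1 - 1 - j = d + 1 by omega,
      show j + d + 1 - 1 - j = d by omega, carrySol, mul_div_assoc', ← sub_div, h,
      mul_div_mul_left _ _ (hne _ _ hj hk)]
  rw [← det_eq_patternSum (v := v) (y := y) (fun j c => by rw [hv0]; exact hw j c)
    (fun j c => by rw [hv0]; exact hwy j c) (fun j => by rw [hv0]; exact hw1 j) hstep le_rfl]
  -- Row i is evaluated i periods after 1 - m, so column j is a constant times the powers of its
  -- multiplier.
  · have hpow : ∀ (j i : ℕ), v m j ((n : ℤ) * i + (1 - m)) = X j ^ i * v m j (1 - m) := by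
      intro j i
      induction i with
      | zero => simp
      | succ i ih =>
        rw [show (n : ℤ) * ((i + 1 : ℕ) : ℤ) + (1 - m) = n * i + (1 - m) + n by push_cast; ring,
          hvp, ih]
        ring
    have hdet : (Matrix.of fun i j : Fin m => v m (m - 1 - j) ((n : ℤ) * i + (1 - m))).det
        = (∏ j : Fin m, v m (m - 1 - j) (1 - m)) *
          (Matrix.vandermonde fun j : Fin m => X (m - 1 - j)).det := by
      rw [← Matrix.det_transpose (Matrix.vandermonde _), ← Matrix.det_mul_row]
      congr 1
      ext i j
      simp only [Matrix.of_apply, Matrix.transpose_apply, Matrix.vandermonde_apply, hpow]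
      ring
    rw [hdet, Matrix.det_vandermonde, prod_vandermonde_rev,
      Fin.prod_univ_eq_prod_range (fun j => v m (m - 1 - j) (1 - m)),
      Finset.prod_range_reflect (fun j => v m j (1 - m)), ← Finset.prod_mul_distrib]
    refine Finset.prod_congr rfl fun l hl => ?_
    -- The Vandermonde factors of the letter l reproduce the denominator of `v m l`, leaving a power
    -- of X_l.
    have h1 : ∏ k ∈ Ioo l m, (X l - X k) = X l ^ (m - 1 - l) * ∏ k ∈ Ioo l m, (1 - X k / X l) := by
      have : m - 1 - l = #(Ioo l m) := by simp; omega
      rw [this, ← Finset.prod_const, ← Finset.prod_mul_distrib]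
      refine Finset.prod_congr rfl fun k _ => ?_
      rw [mul_sub, mul_div_cancel₀ _ (hX l), mul_one]
    have h2 : ∏ k ∈ Ioo l m, (1 - X k / X l) ≠ 0 :=
      Finset.prod_ne_zero_iff.2 fun k hk => hne l k (mem_Ioo.1 hk).1 (mem_Ioo.1 hk).2
    rw [h1]
    simp only [v]
    field_simp
  · intro i j hij
    have : (i : ℤ) < j := by exact_mod_cast hij
    have hn' : (0 : ℤ) < n := by omega
    simp only
    nlinarith
  · intro i
    have : (0 : ℤ) ≤ n * i := by positivity
    omega

end Field

end KRCrystal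

/-! ### Tropicalization: orders as q → 0+ -/

namespace KRCrystal

open Finset Filter Topology

lemma tendsto_const_mul_pow_succ (D : ℝ) (k : ℕ) :
    Tendsto (fun q : ℝ => D * q ^ (k + 1)) (𝓝[>] 0) (𝓝 0) := by
  have : Tendsto (fun q : ℝ => D * q ^ (k + 1)) (𝓝 0) (𝓝 (D * 0 ^ (k + 1))) :=
    Continuous.tendsto (by fun_prop) 0
  rw [zero_pow (Nat.succ_ne_zero k), mul_zero] at this
  exact this.mono_left nhdsWithin_le_nhds

/-- `F q` is bounded above and below by positive multiples of `q ^ v` as `q → 0+`. -/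
def HasOrd (F : ℝ → ℝ) (v : ℤ) : Prop :=
  ∃ c C : ℝ, 0 < c ∧ 0 < C ∧ ∀ᶠ q in 𝓝[>] (0 : ℝ), c * q ^ v ≤ F q ∧ F q ≤ C * q ^ v

namespace HasOrd

lemma const_mul_zpow {k : ℝ} (hk : 0 < k) (v : ℤ) : HasOrd (fun q => k * q ^ v) v :=
  ⟨k, k, hk, hk, Eventually.of_forall fun _ => ⟨le_rfl, le_rfl⟩⟩

lemma one : HasOrd (fun _ => 1) 0 := by simpa using const_mul_zpow one_pos 0

lemma congr {F G : ℝ → ℝ} {v : ℤ} (h : HasOrd F v) (e : F =ᶠ[𝓝[>] 0] G) : HasOrd G v := by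
  obtain ⟨c, C, hc, hC, h⟩ := h
  refine ⟨c, C, hc, hC, ?_⟩
  filter_upwards [h, e] with q h e
  rwa [← e]

lemma mul {F G : ℝ → ℝ} {u v : ℤ} (hF : HasOrd F u) (hG : HasOrd G v) :
    HasOrd (fun q => F q * G q) (u + v) := by
  obtain ⟨c, C, hc, hC, hF⟩ := hF
  obtain ⟨d, D, hd, hD, hG⟩ := hG
  refine ⟨c * d, C * D, mul_pos hc hd, mul_pos hC hD, ?_⟩
  filter_upwards [hF, hG, self_mem_nhdsWithin] with q hF hG hq
  rw [Set.mem_Ioi] at hq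
  have h1 : 0 < q ^ u := zpow_pos hq _
  have h2 : 0 < q ^ v := zpow_pos hq _
  rw [zpow_add₀ hq.ne', mul_mul_mul_comm, mul_mul_mul_comm C]
  have hF0 : 0 ≤ F q := le_trans (by positivity) hF.1
  constructor
  · exact mul_le_mul hF.1 hG.1 (by positivity) hF0
  · exact mul_le_mul hF.2 hG.2 (le_trans (by positivity) hG.1) (by positivity)

lemma prod {ι : Type*} {s : Finset ι} {F : ι → ℝ → ℝ} {v : ι → ℤ}
    (h : ∀ i ∈ s, HasOrd (F i) (v i)) : HasOrd (fun q => ∏ i ∈ s, F i q) (∑ i ∈ s, v i) := by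
  classical
  induction s using Finset.induction_on with
  | empty => simpa using one
  | insert a s ha ih =>
    simp only [prod_insert ha, sum_insert ha]
    exact (h a (mem_insert_self _ _)).mul (ih fun i hi => h i (mem_insert_of_mem hi))

lemma pow {F : ℝ → ℝ} {v : ℤ} (h : HasOrd F v) (k : ℕ) : HasOrd (fun q => F q ^ k) (k * v) := by
  simpa using prod (s := range k) fun _ _ => h

/-- Both functions are eventually positive, so the lowest-order term cannot cancel. -/
lemma add {F G : ℝ → ℝ} {u v : ℤ} (hF : HasOrd F u) (hG : HasOrd G v) :
    HasOrd (fun q => F q + G q) (min u v) := by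
  obtain ⟨c, C, hc, hC, hF⟩ := hF
  obtain ⟨d, D, hd, hD, hG⟩ := hG
  refine ⟨min c d, C + D, lt_min hc hd, add_pos hC hD, ?_⟩
  have hlt : ∀ᶠ q in 𝓝[>] (0 : ℝ), q < 1 :=
    eventually_nhdsWithin_of_eventually_nhds (eventually_lt_nhds one_pos)
  filter_upwards [hF, hG, self_mem_nhdsWithin, hlt] with q hF hG hq hq1
  rw [Set.mem_Ioi] at hq
  have h1 : 0 < q ^ u := zpow_pos hq _
  have h2 : 0 < q ^ v := zpow_pos hq _
  have e1 : q ^ u ≤ q ^ (min u v) := zpow_le_zpow_right_of_le_one₀ hq hq1.le (min_le_left _ _)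
  have e2 : q ^ v ≤ q ^ (min u v) := zpow_le_zpow_right_of_le_one₀ hq hq1.le (min_le_right _ _)
  constructor
  · rcases min_choice u v with h | h <;> rw [h]
    · have : min c d * q ^ u ≤ c * q ^ u := by gcongr; exact min_le_left _ _
      have : 0 < d * q ^ v := by positivity
      linarith
    · have : min c d * q ^ v ≤ d * q ^ v := by gcongr; exact min_le_right _ _
      have : 0 < c * q ^ u := by positivity
      linarith
  · have : C * q ^ u ≤ C * q ^ (min u v) := by gcongr
    have : D * q ^ v ≤ D * q ^ (min u v) := by gcongr
    linarith

lemma sum {ι : Type*} {s : Finset ι} (hs : s.Nonempty) {F : ι → ℝ → ℝ} {v : ι → ℤ}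
    (h : ∀ i ∈ s, HasOrd (F i) (v i)) : HasOrd (fun q => ∑ i ∈ s, F i q) (s.inf' hs v) := by
  classical
  induction hs using Finset.Nonempty.cons_induction with
  | singleton a => simpa using h a
  | cons a s ha hs ih =>
    simp only [sum_cons, inf'_cons hs]
    exact (h a (mem_cons_self _ _)).add (ih fun i hi => h i (mem_cons_of_mem hi))

lemma sum_range {d : ℕ} {F : ℕ → ℝ → ℝ} {v : ℕ → ℤ} (h : ∀ i, HasOrd (F i) (v i)) :
    HasOrd (fun q => ∑ i ∈ range (d + 1), F i q) (runMin v d) := by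
  induction d with
  | zero => simpa [runMin] using h 0
  | succ d ih =>
    simp only [sum_range_succ _ (d + 1)]
    exact ih.add (h _)

/-- If u < v, dividing c q^u ≤ D q^v by q^u bounds the positive constant c by a quantity tending to
0. -/
lemma le {F : ℝ → ℝ} {u v : ℤ} (hu : HasOrd F u) (hv : HasOrd F v) : v ≤ u := by
  obtain ⟨c, C, hc, hC, hF⟩ := hu
  obtain ⟨d, D, hd, hD, hG⟩ := hv
  by_contra! h
  obtain ⟨k, rfl⟩ : ∃ k : ℕ, v = u + (k + 1 : ℕ) := ⟨(v - u - 1).toNat, by omega⟩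
  obtain ⟨q, h1, h2, h3, h4⟩ := (hF.and (hG.and
    (((tendsto_const_mul_pow_succ D k).eventually (gt_mem_nhds hc)).and self_mem_nhdsWithin))).exists
  have h5 := h1.1.trans h2.2
  have h6 : 0 < q ^ u := zpow_pos h4 _
  rw [zpow_add₀ h4.ne', zpow_natCast, mul_left_comm, mul_comm c] at h5
  have := le_of_mul_le_mul_left h5 h6
  linarith

lemma unique {F : ℝ → ℝ} {u v : ℤ} (hu : HasOrd F u) (hv : HasOrd F v) : u = v :=
  le_antisymm (hv.le hu) (hu.le hv)

end HasOrd

/-- The tropical counterpart of `carrySol`. -/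
def tropSol (n : ℕ) (y w : ℕ → ℤ → ℤ) (j : ℕ) : ℕ → ℤ → ℤ
  | 0 => w j
  | d + 1 => fun c =>
      runMin (fun i => ∑ l ∈ range i, y (j + d + 1) (c - 1 - l) + tropSol n y w j d (c - i)) (n - 1)

lemma hasOrd_carrySol {n : ℕ} (hn : 1 < n) {y w : ℝ → ℕ → ℤ → ℝ} {y' w' : ℕ → ℤ → ℤ}
    (hy : ∀ j c, HasOrd (fun q => y q j c) (y' j c))
    (hw : ∀ j c, HasOrd (fun q => w q j c) (w' j c)) (j d : ℕ) (c : ℤ) :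
    HasOrd (fun q => carrySol n (y q) (w q) j d c) (tropSol n y' w' j d c) := by
  induction d generalizing c with
  | zero => exact hw j c
  | succ d ih =>
    obtain ⟨N, rfl⟩ : ∃ N, n = N + 1 := ⟨n - 1, by omega⟩
    exact HasOrd.sum_range fun i => (HasOrd.prod fun l _ => hy _ _).mul (ih _)

/-- The values of the Gelfand-Tsetlin patterns with top row `a`, where a cell with content `c` and
letter `k` contributes `y k c`. -/
def IsPatternValue (y : ℕ → ℤ → ℤ) : (m : ℕ) → (Fin m → ℤ) → ℤ → Prop
  | 0, _, z => z = 0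
  | m + 1, a, z => ∃ b ∈ Fintype.piFinset fun i : Fin m => Ioc (a i.castSucc) (a i.succ),
      ∃ z', IsPatternValue y m b z' ∧
        z = ∑ c ∈ Ico (-(m : ℤ)) (a 0), y m c + (∑ i, ∑ c ∈ Ico (b i) (a i.succ), y m c + z')

/-- The pattern sum has the order of the least pattern value. -/
lemma exists_isLeast_hasOrd_patternSum {y : ℝ → ℕ → ℤ → ℝ} {y' : ℕ → ℤ → ℤ}
    (hy : ∀ j c, HasOrd (fun q => y q j c) (y' j c)) (m : ℕ) (a : Fin m → ℤ) (ha : StrictMono a)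
    (h0 : ∀ i, 1 - (m : ℤ) ≤ a i) :
    ∃ z, IsLeast {z | IsPatternValue y' m a z} z ∧ HasOrd (fun q => patternSum (y q) m a) z := by
  induction m with
  | zero =>
    refine ⟨0, ⟨rfl, fun z hz => ?_⟩, HasOrd.one⟩
    exact le_of_eq (Eq.symm hz)
  | succ m ih =>
    have h0' : ∀ i, -(m : ℤ) ≤ a i := fun i => by have := h0 i; push_cast at this; omega
    have ih' : ∀ b : Fin m → ℤ, ∃ z,
        b ∈ Fintype.piFinset (fun i : Fin m => Ioc (a i.castSucc) (a i.succ)) →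
        IsLeast {z | IsPatternValue y' m b z} z ∧ HasOrd (fun q => patternSum (y q) m b) z := by
      intro b
      by_cases hb : b ∈ Fintype.piFinset fun i : Fin m => Ioc (a i.castSucc) (a i.succ)
      · obtain ⟨hb1, hb2⟩ := strictMono_of_mem_interlacing ha h0' hb
        obtain ⟨z, hz⟩ := ih b hb1 hb2
        exact ⟨z, fun _ => hz⟩
      · exact ⟨0, fun h => absurd h hb⟩
    choose z hz using ih'
    have hne : (Fintype.piFinset fun i : Fin m => Ioc (a i.castSucc) (a i.succ)).Nonempty := by
      rw [Fintype.piFinset_nonempty]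
      intro i
      rw [nonempty_Ioc]
      exact ha Fin.castSucc_lt_succ
    refine ⟨_, ?_, (HasOrd.prod fun c _ => hy m c).mul (HasOrd.sum hne fun b hb =>
      (HasOrd.prod fun i _ => HasOrd.prod fun c _ => hy m c).mul (hz b hb).2)⟩
    constructor
    · obtain ⟨b, hb, e⟩ := exists_mem_eq_inf' hne
        fun b => ∑ i, ∑ c ∈ Ico (b i) (a i.succ), y' m c + z b
      refine ⟨b, hb, z b, (hz b hb).1.1, ?_⟩
      rw [e]
    · rintro _ ⟨b, hb, z', hz', rfl⟩
      have h1 := (hz b hb).1.2 hz'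
      have h2 := inf'_le (fun b => ∑ i, ∑ c ∈ Ico (b i) (a i.succ), y' m c + z b) hb
      linarith

end KRCrystal

/-! ### Gelfand-Tsetlin patterns and semistandard tableaux -/

namespace KRCrystal

open Finset

/-- `T` is a semistandard tableau with row lengths `ℓ` and entries below `m`. -/
structure IsTableau (m : ℕ) (ℓ : ℕ → ℕ) (T : ℕ → ℕ → ℕ) : Prop where
  lt : ∀ i j, j < ℓ i → T i j < m
  row : ∀ i j j', j ≤ j' → j' < ℓ i → T i j ≤ T i j'
  col : ∀ i i' j, i < i' → j < ℓ i' → T i j < T i' j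

/-- The sum of the weights of the cells of a tableau. -/
def tableauValue (y : ℕ → ℤ → ℤ) (m : ℕ) (ℓ : ℕ → ℕ) (T : ℕ → ℕ → ℕ) : ℤ :=
  ∑ i ∈ range m, ∑ j ∈ range (ℓ i), y (T i j) ((j : ℤ) - i)

/-- The partition `ℓ'` with at most `m` rows is obtained from `ℓ` by removing a horizontal strip. -/
structure IsStrip (m : ℕ) (ℓ ℓ' : ℕ → ℕ) : Prop where
  antitone : Antitone ℓ'
  eq_zero : ∀ i, m ≤ i → ℓ' i = 0
  le : ∀ i, ℓ' i ≤ ℓ i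
  ge : ∀ i, ℓ (i + 1) ≤ ℓ' i

/-- The weight of a horizontal strip filled with the letter `m`. -/
def stripValue (y : ℕ → ℤ → ℤ) (m : ℕ) (ℓ ℓ' : ℕ → ℕ) : ℤ :=
  ∑ i ∈ range (m + 1), ∑ j ∈ Ico (ℓ' i) (ℓ i), y m ((j : ℤ) - i)

/-- The strictly increasing sequence attached to a partition with at most `m` rows. -/
def shape (m : ℕ) (ℓ : ℕ → ℕ) (i : Fin m) : ℤ := (ℓ (m - 1 - i) : ℤ) - (m - 1 - i : ℕ)

lemma sum_Ico_natCast_sub (f : ℤ → ℤ) (a b r : ℕ) :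
    ∑ c ∈ Ico ((a : ℤ) - r) ((b : ℤ) - r), f c = ∑ j ∈ Ico a b, f ((j : ℤ) - r) := by
  refine sum_bij' (fun c _ => (c + r).toNat) (fun j _ => (j : ℤ) - r) ?_ ?_ ?_ ?_ ?_
  · intro c hc
    simp only [mem_Ico] at hc ⊢
    omega
  · intro j hj
    simp only [mem_Ico] at hj ⊢
    omega
  · intro c hc
    simp only [mem_Ico] at hc
    omega
  · intro j hj
    omega
  · intro c hc
    simp only [mem_Ico] at hc
    congr 1
    omega

/-- `shape` lists the rows from the bottom up. The initial interval is row m, which lies wholly in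
the strip; the others are the strip cells of rows m - 1, …, 0. -/
lemma IsStrip.sum_shape (y : ℕ → ℤ → ℤ) {m : ℕ} {ℓ ℓ' : ℕ → ℕ} (h : IsStrip m ℓ ℓ') :
    ∑ c ∈ Ico (-(m : ℤ)) (shape (m + 1) ℓ 0), y m c +
      ∑ i : Fin m, ∑ c ∈ Ico (shape m ℓ' i) (shape (m + 1) ℓ i.succ), y m c
      = stripValue y m ℓ ℓ' := by
  rw [stripValue, sum_range_succ, add_comm]
  congr 1
  · rw [← sum_range_reflect, ← Fin.sum_univ_eq_sum_range
      (fun i => ∑ j ∈ Ico (ℓ' (m - 1 - i)) (ℓ (m - 1 - i)), y m ((j : ℤ) - (m - 1 - i : ℕ)))]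
    refine sum_congr rfl fun i _ => ?_
    rw [← sum_Ico_natCast_sub]
    simp only [shape, Fin.val_succ]
    rw [show m + 1 - 1 - ((i : ℕ) + 1) = m - 1 - i by omega]
  · have := sum_Ico_natCast_sub (y m) 0 (ℓ m) m
    rw [h.eq_zero m le_rfl, ← this]
    simp [shape]

lemma isPatternValue_succ_iff (y : ℕ → ℤ → ℤ) {m : ℕ} {ℓ : ℕ → ℕ}
    (h0 : ∀ i, m + 1 ≤ i → ℓ i = 0) (z : ℤ) :
    IsPatternValue y (m + 1) (shape (m + 1) ℓ) z ↔
      ∃ ℓ', IsStrip m ℓ ℓ' ∧ ∃ z', IsPatternValue y m (shape m ℓ') z' ∧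
        z = stripValue y m ℓ ℓ' + z' := by
  constructor
  · rintro ⟨b, hb, z', hz', rfl⟩
    simp only [Fintype.mem_piFinset, mem_Ioc, shape, Fin.val_castSucc, Fin.val_succ] at hb
    -- The inverse of `shape`, extended by zero; interlacing becomes ℓ (r + 1) ≤ ℓ' r ≤ ℓ r.
    let ℓ' : ℕ → ℕ := fun r => if h : r < m then (b ⟨m - 1 - r, by omega⟩ + r).toNat else 0
    have key : ∀ r, r < m → ℓ (r + 1) ≤ ℓ' r ∧ ℓ' r ≤ ℓ r := by
      intro r hr
      have := hb ⟨m - 1 - r, by omega⟩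
      simp only [ℓ', hr, dif_pos]
      simp only at this
      rw [show m + 1 - 1 - (m - 1 - r) = r + 1 by omega,
        show m + 1 - 1 - (m - 1 - r + 1) = r by omega] at this
      push_cast at this
      omega
    have hz : ∀ r, m ≤ r → ℓ' r = 0 := fun r hr => dif_neg (by omega)
    have hge : ∀ r, ℓ (r + 1) ≤ ℓ' r := by
      intro r
      by_cases hr : r < m
      · exact (key r hr).1
      · rw [h0 (r + 1) (by omega)]; exact Nat.zero_le _
    have hle : ∀ r, ℓ' r ≤ ℓ r := by
      intro r
      by_cases hr : r < m
      · exact (key r hr).2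
      · rw [hz r (by omega)]; exact Nat.zero_le _
    have hs : IsStrip m ℓ ℓ' :=
      ⟨antitone_nat_of_succ_le fun r => (hle (r + 1)).trans (hge r), hz, hle, hge⟩
    have hsh : shape m ℓ' = b := by
      funext i
      have := hb i
      have e : (⟨m - 1 - (m - 1 - i), by omega⟩ : Fin m) = i := Fin.ext (by simp only; omega)
      simp only [shape, ℓ', show m - 1 - (i : ℕ) < m by omega, dif_pos, e]
      rw [show m + 1 - 1 - (i : ℕ) = m - 1 - i + 1 by omega] at this
      omega
    refine ⟨ℓ', hs, z', by rwa [hsh], ?_⟩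
    rw [← hs.sum_shape y, hsh]
    ring
  · rintro ⟨ℓ', hs, z', hz', rfl⟩
    refine ⟨shape m ℓ', ?_, z', hz', ?_⟩
    · simp only [Fintype.mem_piFinset, mem_Ioc, shape, Fin.val_castSucc, Fin.val_succ]
      intro i
      have h1 := hs.ge (m - 1 - i)
      have h2 := hs.le (m - 1 - i)
      rw [show m + 1 - 1 - (i : ℕ) = m - 1 - i + 1 by omega,
        show m + 1 - 1 - ((i : ℕ) + 1) = m - 1 - i by omega]
      omega
    · rw [← hs.sum_shape y]
      ring

lemma IsTableau.le_entry {m : ℕ} {ℓ : ℕ → ℕ} (hℓ : Antitone ℓ) {T : ℕ → ℕ → ℕ}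
    (hT : IsTableau m ℓ T) (i j : ℕ) (h : j < ℓ i) : i ≤ T i j := by
  induction i with
  | zero => exact Nat.zero_le _
  | succ i ih =>
    have h1 := ih (h.trans_le (hℓ (Nat.le_succ i)))
    have h2 := hT.col i (i + 1) j (Nat.lt_succ_self i) h
    omega

/-- The cells holding the largest letter m form a horizontal strip; removing or refilling it passes
between tableaux on m + 1 and on m letters. -/
lemma tableauValue_succ_iff (y : ℕ → ℤ → ℤ) {m : ℕ} {ℓ : ℕ → ℕ} (hℓ : Antitone ℓ) (z : ℤ) :
    (∃ T, IsTableau (m + 1) ℓ T ∧ z = tableauValue y (m + 1) ℓ T) ↔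
      ∃ ℓ', IsStrip m ℓ ℓ' ∧ ∃ z', (∃ T, IsTableau m ℓ' T ∧ z' = tableauValue y m ℓ' T) ∧
        z = stripValue y m ℓ ℓ' + z' := by
  have hsplit : ∀ (ℓ' : ℕ → ℕ) (T T' : ℕ → ℕ → ℕ), IsStrip m ℓ ℓ' →
      (∀ i j, j < ℓ' i → T i j = T' i j) → (∀ i j, ℓ' i ≤ j → j < ℓ i → T i j = m) →
      tableauValue y (m + 1) ℓ T = stripValue y m ℓ ℓ' + tableauValue y m ℓ' T' := by
    intro ℓ' T T' hs h1 h2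
    have e : tableauValue y m ℓ' T' = tableauValue y (m + 1) ℓ' T' := by
      rw [tableauValue, tableauValue, sum_range_succ, hs.eq_zero m le_rfl]
      simp
    rw [e, tableauValue, tableauValue, stripValue, ← sum_add_distrib]
    refine sum_congr rfl fun i _ => ?_
    rw [← sum_range_add_sum_Ico _ (hs.le i), add_comm]
    congr 1
    · refine sum_congr rfl fun j hj => ?_
      rw [mem_Ico] at hj
      rw [h2 i j hj.1 hj.2]
    · refine sum_congr rfl fun j hj => ?_
      rw [h1 i j (mem_range.1 hj)]
  constructor
  · rintro ⟨T, hT, rfl⟩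
    classical
    have hex : ∀ i, ∃ k, ℓ i ≤ k ∨ m ≤ T i k := fun i => ⟨ℓ i, Or.inl le_rfl⟩
    -- The column where the letters m of row i begin, or the end of the row if there are none.
    let ℓ' : ℕ → ℕ := fun i => Nat.find (hex i)
    have hlt : ∀ i j, j < ℓ' i → j < ℓ i ∧ T i j < m := by
      intro i j hj
      have := Nat.find_min (hex i) hj
      push Not at this
      exact this
    have hle : ∀ i, ℓ' i ≤ ℓ i := fun i => Nat.find_min' (hex i) (Or.inl le_rfl)
    have hspec : ∀ i, ℓ i ≤ ℓ' i ∨ m ≤ T i (ℓ' i) := fun i => Nat.find_spec (hex i)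
    have hge : ∀ i, ℓ (i + 1) ≤ ℓ' i := by
      intro i
      by_contra! h
      have h1 := hT.col i (i + 1) _ (Nat.lt_succ_self i) h
      have h2 := hT.lt (i + 1) _ h
      have h3 := hℓ (Nat.le_succ i)
      have := hspec i
      simp only [Nat.succ_eq_add_one] at h3
      omega
    have hs : IsStrip m ℓ ℓ' := by
      refine ⟨antitone_nat_of_succ_le fun i => (hle (i + 1)).trans (hge i), fun i hi => ?_, hle, hge⟩
      -- Entries of row i are at least i, so rows from m on have no letter below m.
      by_contra h
      have h1 := hlt i 0 (by omega)
      have h2 := hT.le_entry hℓ i 0 h1.1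
      omega
    refine ⟨ℓ', hs, _, ⟨T, ⟨fun i j hj => (hlt i j hj).2,
      fun i j j' h hj => hT.row i j j' h (hlt i j' hj).1,
      fun i i' j h hj => hT.col i i' j h (hlt i' j hj).1⟩, rfl⟩, ?_⟩
    refine hsplit ℓ' T T hs (fun _ _ _ => rfl) fun i j h1 h2 => ?_
    have h3 := hT.row i _ j h1 h2
    have h4 := hT.lt i j h2
    have := hspec i
    omega
  · rintro ⟨ℓ', hs, _, ⟨T', hT', rfl⟩, rfl⟩
    refine ⟨fun i j => if j < ℓ' i then T' i j else m, ⟨?_, ?_, ?_⟩, ?_⟩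
    · intro i j hj
      have := hT'.lt i j
      split_ifs with h
      · have := this h
        omega
      · omega
    · intro i j j' hjj hj
      have h1 := hT'.lt i j
      have h2 := hT'.row i j j' hjj
      split_ifs with h3 h4 h4
      · exact h2 h4
      · exact (h1 h3).le
      · omega
      · exact le_rfl
    · intro i i' j hii hj
      have h1 : j < ℓ' i := by
        obtain ⟨k, rfl⟩ : ∃ k, i' = k + 1 := ⟨i' - 1, by omega⟩
        exact (hj.trans_le (hs.ge k)).trans_le (hs.antitone (by omega))
      simp only [h1, if_true]
      split_ifs with h2
      · exact hT'.col i i' j hii h2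
      · exact hT'.lt i j h1
    · refine (hsplit ℓ' _ T' hs (fun i j h => if_pos h) fun i j h _ => if_neg (by omega)).symm

/-- Semistandard tableaux and Gelfand-Tsetlin patterns have the same values. -/
theorem isPatternValue_iff_tableau (y : ℕ → ℤ → ℤ) (m : ℕ) {ℓ : ℕ → ℕ} (hℓ : Antitone ℓ)
    (h0 : ∀ i, m ≤ i → ℓ i = 0) (z : ℤ) :
    IsPatternValue y m (shape m ℓ) z ↔ ∃ T, IsTableau m ℓ T ∧ z = tableauValue y m ℓ T := by
  induction m generalizing ℓ z with
  | zero =>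
    have hT : IsTableau 0 ℓ fun _ _ => 0 :=
      ⟨fun i j h => by simp [h0] at h, fun _ _ _ _ _ => le_rfl, fun i i' j _ h => by simp [h0] at h⟩
    exact ⟨fun h => ⟨_, hT, h⟩, fun ⟨T, _, h⟩ => h⟩
  | succ m ih =>
    rw [isPatternValue_succ_iff y h0, tableauValue_succ_iff y hℓ]
    refine exists_congr fun ℓ' => and_congr_right fun hs => exists_congr fun z' => ?_
    rw [ih hs.antitone hs.eq_zero]

end KRCrystal

/-! ### Potentials of carried rows and the intrinsic energy -/

namespace KRCrystal

open Finset Filter Topology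

/-- A primitive of `f` that vanishes at `a`. -/
noncomputable def primitive (f : ℤ → ℤ) (a c : ℤ) : ℤ :=
  ∑ l ∈ Ico a c, f l - ∑ l ∈ Ico c a, f l

lemma primitive_self (f : ℤ → ℤ) (a : ℤ) : primitive f a a = 0 := by simp [primitive]

lemma primitive_add_one (f : ℤ → ℤ) (a c : ℤ) :
    primitive f a (c + 1) = primitive f a c + f c := by
  rcases le_or_gt a c with h | h
  · have h1 : Ico a (c + 1) = insert c (Ico a c) := by
      ext; simp only [mem_Ico, mem_insert]; omega
    have h2 : Ico (c + 1) a = ∅ := Ico_eq_empty (by omega)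
    have h3 : Ico c a = ∅ := Ico_eq_empty (by omega)
    simp only [primitive, h1, h2, h3]
    rw [sum_insert (by simp)]
    simp [add_comm]
  · have h1 : Ico c a = insert c (Ico (c + 1) a) := by
      ext; simp only [mem_Ico, mem_insert]; omega
    have h2 : Ico a (c + 1) = ∅ := Ico_eq_empty (by omega)
    have h3 : Ico a c = ∅ := Ico_eq_empty (by omega)
    simp only [primitive, h1, h2, h3]
    rw [sum_insert (by simp)]
    simp

lemma sum_range_sub_of_step {f g : ℤ → ℤ} (h : ∀ c, g (c + 1) = g c + f c) (c : ℤ) (k : ℕ) :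
    ∑ l ∈ range k, f (c - 1 - l) = g c - g (c - k) := by
  induction k with
  | zero => simp
  | succ k ih =>
    have := h (c - 1 - k)
    rw [show c - 1 - (k : ℤ) + 1 = c - k by ring] at this
    rw [sum_range_succ, ih, this]
    rw [show c - ((k + 1 : ℕ) : ℤ) = c - 1 - k by push_cast; ring]
    ring

/-- The row lengths of the stretched staircase. -/
def staircaseRow (n m i : ℕ) : ℕ := (n - 1) * (m - 1 - i)

lemma mem_staircase_iff (n m i j : ℕ) : (i, j) ∈ staircase n m ↔ j < staircaseRow n m i := by
  rw [← YoungDiagram.mem_cells]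
  simp only [staircase, staircaseRow, mem_filter, mem_product, mem_range]
  refine ⟨fun h => h.2, fun h => ⟨⟨?_, ?_⟩, h⟩⟩
  · by_contra hi
    rw [show m - 1 - i = 0 by omega, mul_zero] at h
    omega
  · exact h.trans_le (Nat.mul_le_mul_left _ (by omega))

lemma antitone_staircaseRow (n m : ℕ) : Antitone (staircaseRow n m) :=
  fun _ _ h => Nat.mul_le_mul_left _ (by omega)

lemma staircaseRow_eq_zero (n m i : ℕ) (h : m ≤ i) : staircaseRow n m i = 0 := by
  rw [staircaseRow, show m - 1 - i = 0 by omega, mul_zero]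

lemma shape_staircaseRow {n : ℕ} (hn : 1 < n) (m : ℕ) :
    shape m (staircaseRow n m) = fun i : Fin m => (n : ℤ) * i + (1 - m) := by
  funext i
  have hi := i.2
  simp only [shape, staircaseRow]
  rw [show m - 1 - (m - 1 - (i : ℕ)) = i by omega]
  have h1 : ((m - 1 - (i : ℕ) : ℕ) : ℤ) = m - 1 - i := by omega
  have h2 : ((n - 1 : ℕ) : ℤ) = n - 1 := by omega
  rw [h1]
  push_cast
  rw [h2]
  ring

lemma sum_staircase_cells (n m : ℕ) (f : ℕ → ℕ → ℤ) :
    ∑ c ∈ (staircase n m).cells, f c.1 c.2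
      = ∑ i ∈ range m, ∑ j ∈ range (staircaseRow n m i), f i j := by
  rw [sum_sigma']
  refine sum_bij' (fun c _ => ⟨c.1, c.2⟩) (fun p _ => (p.1, p.2)) ?_ ?_ ?_ ?_ ?_
  · rintro ⟨i, j⟩ h
    rw [YoungDiagram.mem_cells, mem_staircase_iff] at h
    simp only [mem_sigma, mem_range]
    refine ⟨?_, h⟩
    by_contra hi
    rw [staircaseRow_eq_zero n m i (by omega)] at h
    omega
  · rintro ⟨i, j⟩ h
    simp only [mem_sigma, mem_range] at h
    rw [YoungDiagram.mem_cells, mem_staircase_iff]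
    exact h.2
  · intro c _; rfl
  · intro p _; rfl
  · intro c _; rfl

variable {n : ℕ} [NeZero n] {m : ℕ} {s : Fin m → ℕ}

/-- The number of letters of `b_{k+1}` whose colour is that of a cell of content `c`. -/
def contentCount (b : ∀ i, Row n (s i)) (k : ℕ) (c : ℤ) : ℤ :=
  colored b (k + 1) (-(c : ZMod n))

lemma contentCount_eq (b : ∀ i, Row n (s i)) {k : ℕ} (hk : k < m) (c : ℤ) :
    contentCount b k c = (b ⟨k, hk⟩).icount (-c - k) := by
  have : 1 ≤ k + 1 ∧ k + 1 ≤ m := by omega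
  simp only [contentCount, colored, dif_pos this, Row.icount]
  congr 2
  push_cast
  ring

lemma contentCount_eq_zero (b : ∀ i, Row n (s i)) {k : ℕ} (hk : m ≤ k) (c : ℤ) :
    contentCount b k c = 0 := by
  have : ¬ (1 ≤ k + 1 ∧ k + 1 ≤ m) := by omega
  simp only [contentCount, colored, dif_neg this, Nat.cast_zero]

lemma contentCount_add_period (b : ∀ i, Row n (s i)) (k : ℕ) (c : ℤ) :
    contentCount b k (c + n) = contentCount b k c := by
  simp [contentCount]

/-- The length of `b_{k+1}`, or `0` when there is no such factor. -/
def rowLength (s : Fin m → ℕ) (k : ℕ) : ℕ := if h : k < m then s ⟨k, h⟩ else 0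

lemma sum_contentCount (b : ∀ i, Row n (s i)) (k : ℕ) (c : ℤ) :
    ∑ l ∈ range n, contentCount b k (c - 1 - l) = rowLength s k := by
  by_cases hk : k < m
  · simp only [contentCount_eq b hk, rowLength, dif_pos hk]
    rw [← (b ⟨k, hk⟩).sum_icount, ← sum_zmod_eq_sum_range _ (-c + 1 - k : ZMod n)]
    refine sum_congr rfl fun l _ => ?_
    congr 1
    push_cast
    ring
  · simp [contentCount_eq_zero b (not_lt.1 hk), rowLength, hk]

/-- The tropical solutions attached to `b`, carried to the right. -/
noncomputable def potential (b : ∀ i, Row n (s i)) : ℕ → ℕ → ℤ → ℤ :=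
  tropSol n (contentCount b) fun j => primitive (contentCount b j) (-j)

lemma primitive_add_period (b : ∀ i, Row n (s i)) (j : ℕ) (c : ℤ) :
    primitive (contentCount b j) (-j) (c + n)
      = primitive (contentCount b j) (-j) c + rowLength s j := by
  have := sum_range_sub_of_step (primitive_add_one (contentCount b j) (-j)) (c + n) n
  rw [sum_contentCount, add_sub_cancel_right] at this
  omega

lemma potential_add_period (b : ∀ i, Row n (s i)) (j d : ℕ) (c : ℤ) :
    potential b j d (c + n) = potential b j d c + rowLength s j := by
  induction d generalizing c with
  | zero => exact primitive_add_period b j c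
  | succ d ih =>
    simp only [potential, tropSol] at ih ⊢
    rw [← runMin_add_const]
    refine runMin_congr fun i _ => ?_
    rw [show c + n - (i : ℤ) = c - i + n by ring, ih, ← add_assoc]
    congr 2
    refine sum_congr rfl fun l _ => ?_
    rw [show c + n - 1 - (l : ℤ) = c - 1 - l + n by ring, contentCount_add_period]

/-- One step of carrying, given the increments of the potential. -/
lemma potential_succ (b : ∀ i, Row n (s i)) {j d t : ℕ} (h : j + d + 1 < m) (x : Row n t)
    (hx : ∀ c, potential b j d (c + 1) = potential b j d c + x.icount (-c - j - d)) (c : ℤ) :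
    potential b j (d + 1) c
      = Tensor.localMin (x, b ⟨j + d + 1, h⟩) (-c - j - d - 1)
        + potential b j d (c - n + 1) := by
  have h1 : potential b j (d + 1) c = runMin (fun i =>
    ∑ l ∈ range i, contentCount b (j + d + 1) (c - 1 - l) + potential b j d (c - i)) (n - 1) := rfl
  rw [h1, Tensor.localMin, localMin, ← runMin_add_const]
  refine runMin_congr fun k hk => ?_
  have hn0 : 0 < n := Nat.pos_of_ne_zero (NeZero.ne n)
  rw [pathSum]
  refine Eq.trans ?_ (add_assoc _ _ _).symm
  congr 1
  · refine sum_congr rfl fun l _ => ?_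
    refine (contentCount_eq b h _).trans (congrArg _ ?_)
    push_cast
    ring
  · have h2 := sum_range_sub_of_step hx (c - k) (n - 1 - k)
    rw [sum_Ico_eq_sum_range, show c - n + 1 = c - k - ((n - 1 - k : ℕ) : ℤ) by omega]
    have h3 : ∀ l : ℕ, x.icount (-((c - k - 1 - l : ℤ) : ZMod n) - j - d)
        = x.icount (-(c : ZMod n) - j - d - 1 + 2 + ((k + l : ℕ) : ZMod n)) := by
      intro l
      congr 1
      push_cast
      ring
    simp only [h3] at h2
    rw [h2]
    ring

/-- Subtracting `potential_succ` at c from its instance at c + 1 gives x_r + `localMin (r - 1)` -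
`localMin r`, which is the second factor of the R-matrix. -/
lemma potential_add_one (hn : 1 < n) (b : ∀ i, Row n (s i)) (i : Fin m) {d : ℕ} (h : i + d < m)
    (c : ℤ) :
    potential b i d (c + 1) = potential b i d c + (carry b i d).icount (-c - (i : ℕ) - d) := by
  induction d generalizing c with
  | zero =>
    have h1 := primitive_add_one (contentCount b i) (-(i : ℕ)) c
    rw [contentCount_eq b i.2] at h1
    simpa [carry, potential, tropSol] using h1
  | succ d ih =>
    have ih' := ih (by omega)
    have hd : (i : ℕ) + d + 1 < m := by omega
    rw [potential_succ b hd _ ih' (c + 1), potential_succ b hd _ ih' c, carry, dif_pos hd,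
      combR_eq_swap hn, Tensor.icount_swap_snd]
    rw [show c + 1 - n + 1 = c - n + 1 + 1 by ring, ih' (c - n + 1)]
    have e1 : -((c - n + 1 : ℤ) : ZMod n) - (i : ℕ) - d = -c - (i : ℕ) - (d + 1 : ℕ) := by
      push_cast
      rw [ZMod.natCast_self]
      ring
    have e2 : -((c + 1 : ℤ) : ZMod n) - (i : ℕ) - d - 1 = -c - (i : ℕ) - (d + 1 : ℕ) - 1 := by
      push_cast
      ring
    have e3 : -(c : ZMod n) - (i : ℕ) - d - 1 = -c - (i : ℕ) - (d + 1 : ℕ) := by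
      push_cast
      ring
    rw [e1, e2, e3]
    ring

/-- The energy of carrying `b_i` past the next `d` factors. -/
lemma sum_coenergy_carry (hn : 1 < n) (b : ∀ i, Row n (s i)) (i : Fin m) {d : ℕ} (h : i + d < m) :
    ∑ k ∈ range d, (if h : i + k + 1 < m then
        coenergy n (s i) (s ⟨i + k + 1, h⟩) (carry b i k, b ⟨i + k + 1, h⟩) else 0)
      = d * s i + potential b i d (-(i + d : ℕ)) := by
  induction d with
  | zero => simp [potential, tropSol, primitive_self]
  | succ d ih =>
    have hd : (i : ℕ) + d + 1 < m := by omega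
    rw [sum_range_succ, ih (by omega), dif_pos hd, coenergy_eq_localMin hn]
    have h1 := potential_add_period b i (d + 1) (-(i + (d + 1) : ℕ))
    -- The argument is chosen so that `localMin` is taken at the letter 0, where it is the coenergy.
    -- Returning by one period costs s_i.
    have h2 := potential_succ b hd _ (potential_add_one hn b i (by omega))
      (-(i + (d + 1) : ℕ) + n)
    have e1 : -((-(i + (d + 1) : ℕ) + n : ℤ) : ZMod n) - (i : ℕ) - d - 1 = 0 := by
      push_cast
      rw [ZMod.natCast_self]
      ring
    have e2 : -((i + (d + 1) : ℕ) : ℤ) + n - n + 1 = -(i + d : ℕ) := by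
      push_cast
      ring
    rw [e1, e2] at h2
    simp only [rowLength, i.2, dif_pos] at h1
    rw [h1] at h2
    push_cast at h2 ⊢
    linarith

lemma intrinsicEnergy_eq (hn : 1 < n) (b : ∀ i, Row n (s i)) :
    intrinsicEnergy b = ∑ l ∈ range m,
      ((m - 1 - l : ℕ) * (rowLength s l : ℤ) + potential b l (m - 1 - l) (1 - m)) := by
  rw [intrinsicEnergy, ← Fin.sum_univ_eq_sum_range
    (fun l => ((m - 1 - l : ℕ) * (rowLength s l : ℤ) + potential b l (m - 1 - l) (1 - m)))]
  refine sum_congr rfl fun i _ => ?_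
  have h := sum_coenergy_carry hn b i (d := m - 1 - i) (by omega)
  rw [show (-((i + (m - 1 - i) : ℕ) : ℤ)) = 1 - m by omega] at h
  simp only [rowLength, i.2, dif_pos]
  rw [← h]
  refine sum_bij' (fun j _ => (j : ℕ) - i - 1)
    (fun k hk => ⟨i + k + 1, by rw [mem_range] at hk; omega⟩) ?_ ?_ ?_ ?_ ?_
  · intro j hj
    rw [mem_Ioi, Fin.lt_def] at hj
    rw [mem_range]
    omega
  · intro k hk
    rw [mem_Ioi, Fin.lt_def]
    simp only
    omega
  · intro j hj
    rw [mem_Ioi, Fin.lt_def] at hj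
    apply Fin.ext
    simp only
    omega
  · intro k hk
    simp only
    omega
  · intro j hj
    rw [mem_Ioi, Fin.lt_def] at hj
    obtain ⟨k, hk, rfl⟩ : ∃ k, ∃ hk : (i : ℕ) + k + 1 < m, j = ⟨i + k + 1, hk⟩ :=
      ⟨j - i - 1, by omega, Fin.ext (by simp only; omega)⟩
    have e : (i : ℕ) + k + 1 - i - 1 = k := by omega
    have key : ∀ k', k' = k →
        coenergy n (s i) (s ⟨i + k + 1, hk⟩) (carry b i k', b ⟨i + k + 1, hk⟩)
          = if h : i + k' + 1 < m then
              coenergy n (s i) (s ⟨i + k' + 1, h⟩) (carry b i k', b ⟨i + k' + 1, h⟩) else 0 := by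
      rintro _ rfl
      rw [dif_pos hk]
    exact key _ e

/-! ### Comparison of orders and the final minimum -/

lemma eventually_const_mul_pow_lt {k : ℝ} (hk : 0 < k) (k' : ℝ) {a a' : ℕ} (h : a < a') :
    ∀ᶠ q in 𝓝[>] (0 : ℝ), k' * q ^ a' < k * q ^ a := by
  obtain ⟨d, rfl⟩ : ∃ d, a' = d + 1 + a := ⟨a' - a - 1, by omega⟩
  filter_upwards [(tendsto_const_mul_pow_succ k' d).eventually (gt_mem_nhds hk),
    self_mem_nhdsWithin] with q hq hq0
  rw [pow_add, ← mul_assoc]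
  exact mul_lt_mul_of_pos_right hq (pow_pos hq0 a)

lemma eventually_ne_const_mul_pow {k k' : ℝ} (hk : 0 < k) (hk' : 0 < k') (h : k ≠ k') (a a' : ℕ) :
    ∀ᶠ q in 𝓝[>] (0 : ℝ), k * q ^ a ≠ k' * q ^ a' := by
  rcases lt_trichotomy a a' with haa | rfl | haa
  · filter_upwards [eventually_const_mul_pow_lt hk k' haa] with q hq
    exact hq.ne'
  · filter_upwards [self_mem_nhdsWithin] with q hq e
    exact h (mul_right_cancel₀ (pow_pos hq a).ne' e)
  · filter_upwards [eventually_const_mul_pow_lt hk' k haa] with q hq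
    exact hq.ne

lemma prod_zpow_eq_zpow_sum {q : ℝ} (hq : q ≠ 0) (f : ℕ → ℤ) (k : ℕ) :
    ∏ l ∈ range k, q ^ f l = q ^ ∑ l ∈ range k, f l := by
  induction k with
  | zero => simp
  | succ k ih => rw [prod_range_succ, sum_range_succ, zpow_add₀ hq, ih]

/-- The least value of a tableau of stretched staircase shape. -/
lemma isLeast_isPatternValue (hn : 1 < n) (b : ∀ i, Row n (s i)) :
    IsLeast {z | IsPatternValue (contentCount b) m (fun i => (n : ℤ) * i + (1 - m)) z}
      (∑ l ∈ range m,
        ((m - 1 - l : ℕ) * (rowLength s l : ℤ) + potential b l (m - 1 - l) (1 - m))) := by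
  -- Distinct positive constants keep the multipliers X_j distinct for small q even when rows have
  -- equal length, without changing any order.
  let κ : ℕ → ℝ := fun j => j + 1
  have hκ : ∀ j, 0 < κ j := fun j => by positivity
  let y : ℝ → ℕ → ℤ → ℝ := fun q j c => κ j * q ^ contentCount b j c
  -- The exponent c + j normalizes the solution to be 1 at c = -j and supplies one factor κ_j per
  -- step.
  let w : ℝ → ℕ → ℤ → ℝ := fun q j c =>
    κ j ^ (c + j) * q ^ primitive (contentCount b j) (-j) c
  let X : ℝ → ℕ → ℝ := fun q j => κ j ^ n * q ^ rowLength s j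
  have hy : ∀ j c, HasOrd (fun q => y q j c) (contentCount b j c) :=
    fun j c => HasOrd.const_mul_zpow (hκ j) _
  have hw : ∀ j c, HasOrd (fun q => w q j c) (primitive (contentCount b j) (-j) c) :=
    fun j c => HasOrd.const_mul_zpow (zpow_pos (hκ j) _) _
  have hX : ∀ j, HasOrd (fun q => X q j) (rowLength s j) := by
    intro j
    have := HasOrd.const_mul_zpow (pow_pos (hκ j) n) (rowLength s j)
    simpa using this
  obtain ⟨z, hz, hzS⟩ := exists_isLeast_hasOrd_patternSum hy m
    (fun i => (n : ℤ) * i + (1 - m))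
    (fun i j hij => by
      have : (i : ℤ) < j := by exact_mod_cast hij
      have hn' : (0 : ℤ) < n := by omega
      simp only
      nlinarith)
    (fun i => by
      have : (0 : ℤ) ≤ n * i := by positivity
      omega)
  have hne : ∀ᶠ q in 𝓝[>] (0 : ℝ), ∀ j ∈ range m, ∀ k ∈ range m, j < k → X q k ≠ X q j := by
    simp only [Filter.eventually_all_finset]
    intro j _ k _
    by_cases hjk : j < k
    · filter_upwards [eventually_ne_const_mul_pow (pow_pos (hκ k) n) (pow_pos (hκ j) n)
        (fun e => by
          have := (pow_left_inj₀ (hκ k).le (hκ j).le (by omega)).1 e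
          simp only [κ, add_left_inj, Nat.cast_inj] at this
          omega) (rowLength s k) (rowLength s j)] with q hq _
      exact hq
    · exact Eventually.of_forall fun q h => absurd h hjk
  have hfac : (fun q => patternSum (y q) m (fun i => (n : ℤ) * i + (1 - m))) =ᶠ[𝓝[>] 0]
      fun q => ∏ l ∈ range m, X q l ^ (m - 1 - l) * carrySol n (y q) (w q) l (m - 1 - l) (1 - m) := by
    filter_upwards [hne, self_mem_nhdsWithin] with q hne hq
    rw [Set.mem_Ioi] at hq
    refine patternSum_staircase hn (fun j => ?_) (fun j k hjk hk => ?_) (fun j c => ?_)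
      (fun j c => ?_) (fun j => ?_) (fun j c => ?_) (fun j c => ?_) (fun j c => ?_)
    · exact (mul_pos (pow_pos (hκ j) _) (pow_pos hq _)).ne'
    · exact hne j (by rw [mem_range]; omega) k (by rwa [mem_range]) hjk
    · exact (mul_pos (zpow_pos (hκ j) _) (zpow_pos hq _)).ne'
    · simp only [w, y, primitive_add_one]
      rw [zpow_add₀ hq.ne', show c + 1 + (j : ℤ) = c + j + 1 by ring, zpow_add_one₀ (hκ j).ne']
      ring
    · simp [w, primitive_self]
    · simp only [y, contentCount_add_period]
    · simp only [y, X, prod_mul_distrib, prod_const, card_range]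
      rw [prod_zpow_eq_zpow_sum hq.ne', sum_contentCount, zpow_natCast]
    · simp only [w, X, primitive_add_period]
      rw [zpow_add₀ hq.ne', show c + n + (j : ℤ) = c + j + n by ring, zpow_add₀ (hκ j).ne',
        zpow_natCast, zpow_natCast]
      ring
  have hord : HasOrd (fun q => ∏ l ∈ range m,
      X q l ^ (m - 1 - l) * carrySol n (y q) (w q) l (m - 1 - l) (1 - m))
      (∑ l ∈ range m,
        ((m - 1 - l : ℕ) * (rowLength s l : ℤ) + potential b l (m - 1 - l) (1 - m))) :=
    HasOrd.prod fun l _ => ((hX l).pow _).mul (hasOrd_carrySol hn hy hw _ _ _)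
  rwa [(hzS.congr hfac).unique hord] at hz

/-- The values of semistandard tableaux of stretched staircase shape are pattern values. -/
lemma exists_semistandard_iff (hn : 1 < n) (b : ∀ i, Row n (s i)) (z : ℤ) :
    (∃ T : SemistandardYoungTableau (staircase n m),
      (∀ i j, (i, j) ∈ staircase n m → 1 ≤ T i j ∧ T i j ≤ m) ∧
      z = ∑ c ∈ (staircase n m).cells,
        (colored b (T c.1 c.2) ((c.1 : ZMod n) - (c.2 : ZMod n)) : ℤ)) ↔
      IsPatternValue (contentCount b) m (fun i => (n : ℤ) * i + (1 - m)) z := by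
  rw [← shape_staircaseRow hn, isPatternValue_iff_tableau _ m (antitone_staircaseRow n m)
    (staircaseRow_eq_zero n m)]
  have hval : ∀ (T : ℕ → ℕ → ℕ) (T' : ℕ → ℕ → ℕ),
      (∀ i j, j < staircaseRow n m i → T i j = T' i j + 1) →
      ∑ c ∈ (staircase n m).cells,
        (colored b (T c.1 c.2) ((c.1 : ZMod n) - (c.2 : ZMod n)) : ℤ)
      = tableauValue (contentCount b) m (staircaseRow n m) T' := by
    intro T T' h
    rw [sum_staircase_cells n m fun i j => (colored b (T i j) ((i : ZMod n) - (j : ZMod n)) : ℤ),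
      tableauValue]
    refine sum_congr rfl fun i _ => sum_congr rfl fun j hj => ?_
    rw [h i j (mem_range.1 hj), contentCount]
    congr 2
    push_cast
    ring
  constructor
  · rintro ⟨T, hT, rfl⟩
    simp only [mem_staircase_iff] at hT
    refine ⟨fun i j => T i j - 1, ⟨fun i j h => ?_, fun i j j' hj h => ?_, fun i i' j hi h => ?_⟩, ?_⟩
    · have := hT i j h
      omega
    · have := T.row_weak_of_le hj ((mem_staircase_iff n m i j').2 h)
      omega
    · have h1 := T.col_strict hi ((mem_staircase_iff n m i' j).2 h)
      have h2 := hT i j (h.trans_le (antitone_staircaseRow n m hi.le))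
      omega
    · refine hval (fun i j => T i j) _ fun i j h => ?_
      have := hT i j h
      omega
  · rintro ⟨T, hT, rfl⟩
    -- Letters are shifted back to 1, …, m; the value 0 off the shape is the convention of
    -- `SemistandardYoungTableau`.
    refine ⟨⟨fun i j => if j < staircaseRow n m i then T i j + 1 else 0, ?_, ?_, ?_⟩, ?_, ?_⟩
    · intro i j j' hj h
      rw [mem_staircase_iff] at h
      rw [if_pos (hj.trans h), if_pos h]
      exact Nat.succ_le_succ (hT.row i j j' hj.le h)
    · intro i i' j hi h
      rw [mem_staircase_iff] at h
      rw [if_pos (h.trans_le (antitone_staircaseRow n m hi.le)), if_pos h]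
      exact Nat.succ_lt_succ (hT.col i i' j hi h)
    · intro i j h
      rw [mem_staircase_iff] at h
      exact if_neg h
    · intro i j h
      rw [mem_staircase_iff] at h
      change 1 ≤ (if j < staircaseRow n m i then T i j + 1 else 0) ∧
        (if j < staircaseRow n m i then T i j + 1 else 0) ≤ m
      rw [if_pos h]
      have := hT.lt i j h
      omega
    · exact (hval (fun i j => if j < staircaseRow n m i then T i j + 1 else 0) T
        fun i j h => if_pos h).symm

end KRCrystal

theorem theorem1 (n : ℕ) [NeZero n] (hn : 1 < n) (m : ℕ) (s : Fin m → ℕ)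
    (b : ∀ i, KRCrystal.Row n (s i)) :
    IsLeast
      {v : ℤ | ∃ T : SemistandardYoungTableau (KRCrystal.staircase n m),
        (∀ i j, (i, j) ∈ KRCrystal.staircase n m → 1 ≤ T i j ∧ T i j ≤ m) ∧
        v = ∑ c ∈ (KRCrystal.staircase n m).cells,
          (KRCrystal.colored b (T c.1 c.2) ((c.1 : ZMod n) - (c.2 : ZMod n)) : ℤ)}
      (KRCrystal.intrinsicEnergy b) := by
  simp only [KRCrystal.exists_semistandard_iff hn b]
  rw [KRCrystal.intrinsicEnergy_eq hn b]
  exact KRCrystal.isLeast_isPatternValue hn b
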